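/- For a finite group $G$ and a subset $S\subseteq G$ with $S=S^{-1}$ and $1\notin S$, the Cayley graph $\mathrm{Cay}(G,S)$ has vertex set $G$ and edge set $\{\{g,sg\}: g\in G,\ s\in S\}$. A finite graph is integral if all eigenvalues of its adjacency matrix are integers. Let $\mathcal{G}_4$ be the class of finite groups $G$ such that $\mathrm{Cay}(G,S)$ is integral for every $S\subseteq G$ with $S=S^{-1}$, $1\notin S$ and $|S|\le 4$. For an abelian group $A$ with a unique element $y$ of order $2$, let $\mathrm{Dic}(A)$ be the generalized dicyclic group over $A$, that is, the group of order $2|A|$ generated by $A$ and an element $x\notin A$ with $x^2=y$ and $x^{-1}ax=a^{-1}$ for all $a\in A$. Let $G$ be a finite group that is not nilpotent. If $G\in\mathcal{G}_4$, then $G\cong S_3$ or $G\cong \mathrm{Dic}(\mathbb{Z}_3^n\times\mathbb{Z}_6)$ for some integer $n\ge 0$. -/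

import Mathlib

/-- The Cayley graph `Cay(G, S)` of a symmetric subset `S` of `G` that does not contain the
identity: its vertices are the elements of `G` and its edges are the pairs `{g, s * g}` with
`g ∈ G` and `s ∈ S`. -/
def cayleyGraph {G : Type*} [Group G] (S : Set G) (hS : S⁻¹ = S) (h1 : (1 : G) ∉ S) :
    SimpleGraph G where
  Adj g h := ∃ s ∈ S, h = s * g
  symm := by
    constructor
    rintro g h ⟨s, hs, rfl⟩
    refine ⟨s⁻¹, ?_, by group⟩
    rw [← hS]
    simpa using hs
  loopless := by
    constructor
    rintro g ⟨s, hs, h⟩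
    have : s = 1 := by simpa using h.symm
    exact h1 (this ▸ hs)

open Classical in
/-- A finite graph is integral if all eigenvalues of its adjacency matrix are integers. -/
def IsIntegralGraph {V : Type*} [Fintype V] (Γ : SimpleGraph V) : Prop :=
  ∀ μ : ℂ, Module.End.HasEigenvalue (Matrix.toLin' (Γ.adjMatrix ℂ)) μ → ∃ z : ℤ, μ = (z : ℂ)

/-- Membership of the finite group `G` in the class `𝒢ₖ`: the graph `Cay(G, S)` is integral for
each symmetric subset `S` of `G` without the identity and with `|S| ≤ k`. -/
def InCayleyClass (k : ℕ) (G : Type*) [Group G] [Fintype G] : Prop :=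
  ∀ (S : Set G) (hS : S⁻¹ = S) (h1 : (1 : G) ∉ S), S.ncard ≤ k →
    IsIntegralGraph (cayleyGraph S hS h1)

/-- The generalized dicyclic group `Dic(A, y)` over the (additively written) abelian group `A`
with respect to an element `y` of order two: it is generated by `A` and an element `x` subject to
`x² = y` and `x⁻¹ a x = a⁻¹` for `a ∈ A`. Its elements are `a` and `a x`, for `a ∈ A`; the first
are written `of a`, the second `ofX a`. The type is the set of these elements; the group structure
is given below under the hypothesis that `y` has order two. -/
inductive GenDicyclic (A : Type*) (y : A) : Type _
  | of : A → GenDicyclic A y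
  | ofX : A → GenDicyclic A y

namespace GenDicyclic

variable {A : Type*} [AddCommGroup A] {y : A}

/-- The product, computed from `x b = b⁻¹ x` for `b ∈ A` and `x² = y`. -/
protected def mul : GenDicyclic A y → GenDicyclic A y → GenDicyclic A y
  | of a, of b => of (a + b)
  | of a, ofX b => ofX (a + b)
  | ofX a, of b => ofX (a - b)
  | ofX a, ofX b => of (a - b + y)

/-- The inverse; `(a x)⁻¹ = (a + y) x`. -/
protected def inv : GenDicyclic A y → GenDicyclic A y
  | of a => of (-a)
  | ofX a => ofX (a + y)

theorem y_add_y (hy : addOrderOf y = 2) : y + y = 0 := by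
  have h := addOrderOf_nsmul_eq_zero y
  rwa [hy, two_nsmul] at h

instance [hy : Fact (addOrderOf y = 2)] : Group (GenDicyclic A y) where
  mul := GenDicyclic.mul
  one := of 0
  inv := GenDicyclic.inv
  mul_assoc := by
    have h : -y = y := neg_eq_of_add_eq_zero_left (y_add_y hy.out)
    rintro (a | a) (b | b) (c | c)
    · exact congrArg of (by abel)
    · exact congrArg ofX (by abel)
    · exact congrArg ofX (by abel)
    · exact congrArg of (by abel)
    · exact congrArg ofX (by abel)
    · exact congrArg of (by abel)
    · exact congrArg of (by abel)
    · refine congrArg ofX ?_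
      calc a - b + y + c = a - b + -y + c := by rw [h]
        _ = a - (b - c + y) := by abel
  one_mul := by
    rintro (a | a)
    · exact congrArg of (zero_add a)
    · exact congrArg ofX (zero_add a)
  mul_one := by
    rintro (a | a)
    · exact congrArg of (add_zero a)
    · exact congrArg ofX (sub_zero a)
  inv_mul_cancel := by
    rintro (a | a)
    · exact congrArg of (neg_add_cancel a)
    · refine congrArg of ?_
      calc a + y - a + y = y + y := by abel
        _ = 0 := y_add_y hy.out

end GenDicyclic

/-- The element `(0, 3)`, which is the unique involution of `ℤ₃ⁿ × ℤ₆`, has order two. -/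
instance fact_addOrderOf_zero_three (n : ℕ) :
    Fact (addOrderOf ((0, 3) : (Fin n → ZMod 3) × ZMod 6) = 2) := by
  refine ⟨addOrderOf_eq_prime (p := 2) ?_ ?_⟩
  · rw [two_nsmul]
    exact Prod.ext (add_zero 0) (by change (3 + 3 : ZMod 6) = 0; decide)
  · intro h
    have h3 : (3 : ZMod 6) = 0 := congrArg Prod.snd h
    exact absurd h3 (by decide)

/-- The generalized dicyclic group `Dic(ℤ₃ⁿ × ℤ₆)`. -/
abbrev DicThreeSix (n : ℕ) : Type :=
  GenDicyclic ((Fin n → ZMod 3) × ZMod 6) (0, 3)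

/-!
The adjacency operator of `Cay(G, S)` is the left multiplication by `s = ∑_{g ∈ S} g` on the group
algebra `ℂ[G]`. So `Cay(G, S)` is not integral if there is a nonzero `w ∈ ℂ[G]` with
`s² w = p s w + q w` for integers `p`, `q` such that `X² - p X - q` has no integer root
(`IntegralSpectrum.eq_zero`). All small configurations that have to be excluded are excluded by
such a vector `w`, written down as a signed sum of group elements; only the relations between the
elements of `S` are used, and no subgroup has to be identified.

Valency two gives that every element satisfies `g⁴ = 1` or `g⁶ = 1`. Two involutions, or two
elements of order four with the same square `z`, taken modulo `⟨z⟩`, have a product of order at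
most three (`InCayleyClass.sq_or_cube_mul`). Further configurations exclude `A₄`, `SL(2, 3)`,
`S₃ × ℤ₃` and `ℤ₃² ⋊ ℤ₂`, the last one also as a quotient of the group generated by three
involutions.

If two involutions `a`, `b` do not commute, they generate `S₃`; the exclusions show that all
involutions lie in `⟨a, b⟩` and that its centralizer is trivial. So conjugation embeds `G` into
the permutations of three involutions, and `G ≅ S₃`.

If all involutions commute, they commute with the elements of order three, since `A₄` is excluded.
As `G` is not nilpotent, some `2`-element does not commute with some `3`-element
(`isNilpotent_of_commute`), so there are elements of order three and of order four. Each element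
of order four inverts each element of order three (`InCayleyClass.conj_eq_inv`), the elements of
order three commute, and there is only one involution. Such a group is `Dic(ℤ₃ⁿ × ℤ₆)`
(`exists_mulEquiv_dicThreeSix`).
-/

/-! ### Spectra of elements of the group algebra -/

/-- The element `s` of the group algebra `ℂ[G]` has integral spectrum if all eigenvalues of the
left multiplication by `s` are integers. -/
def IntegralSpectrum {G : Type*} [Group G] (s : MonoidAlgebra ℂ G) : Prop :=
  ∀ (μ : ℂ) (w : MonoidAlgebra ℂ G), w ≠ 0 → s * w = μ • w → ∃ n : ℤ, μ = n

section GroupAlgebra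

variable {G : Type*} [Group G]

theorem coeff_sum_map_of_mul (L : List G) (w : MonoidAlgebra ℂ G) (g : G) :
    ((L.map (MonoidAlgebra.of ℂ G)).sum * w).coeff g = (L.map fun t => w.coeff (t⁻¹ * g)).sum := by
  induction L with
  | nil => simp
  | cons a L ih => simp [add_mul, ih, MonoidAlgebra.of_apply, MonoidAlgebra.coeff_single_mul_apply]

/-- The adjacency operator of `Cay(G, S)` is the left multiplication by `∑_{s ∈ S} s`. -/
theorem InCayleyClass.integralSpectrum [Fintype G] {k : ℕ} (hG : InCayleyClass k G) (L : List G)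
    (hnd : L.Nodup) (hlen : L.length ≤ k) (hinv : ∀ g ∈ L, g⁻¹ ∈ L) (h1 : (1 : G) ∉ L) :
    IntegralSpectrum (L.map (MonoidAlgebra.of ℂ G)).sum := by
  classical
  intro μ w hw hμ
  have hS : ({g | g ∈ L} : Set G)⁻¹ = {g | g ∈ L} := by
    ext g
    simp only [Set.mem_inv, Set.mem_ofPred_eq]
    exact ⟨fun h => by simpa using hinv _ h, fun h => hinv _ h⟩
  have hcard : ({g | g ∈ L} : Set G).ncard ≤ k := by
    have : ({g | g ∈ L} : Set G) = (L.toFinset : Set G) := by ext; simp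
    rw [this, Set.ncard_coe_finset]
    exact (List.toFinset_card_le L).trans hlen
  refine hG {g | g ∈ L} hS h1 hcard μ ?_
  have hf : (w.coeff : G → ℂ) ≠ 0 := by
    intro h
    apply hw
    ext g
    simpa using congrFun h g
  refine Module.End.hasEigenvalue_of_hasEigenvector (x := (w.coeff : G → ℂ)) ⟨?_, hf⟩
  rw [Module.End.mem_eigenspace_iff]
  funext g
  have h2 : μ * w.coeff g = ∑ t ∈ L.toFinset, w.coeff (t⁻¹ * g) := by
    rw [List.sum_toFinset _ hnd, ← coeff_sum_map_of_mul, hμ]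
    simp
  have h3 : ∑ t ∈ L.toFinset, w.coeff (t⁻¹ * g) = ∑ t ∈ L.toFinset, w.coeff (t * g) := by
    refine Finset.sum_equiv (Equiv.inv G) ?_ ?_
    · intro t
      simp only [List.mem_toFinset, Equiv.inv_apply]
      exact ⟨fun h => hinv _ h, fun h => by simpa using hinv _ h⟩
    · simp
  rw [Pi.smul_apply, smul_eq_mul, h2, h3, Matrix.toLin'_apply, Matrix.mulVec, dotProduct]
  simp only [SimpleGraph.adjMatrix_apply, ite_mul, one_mul, zero_mul]
  rw [← Finset.sum_filter]
  symm
  refine Finset.sum_bij (fun t _ => t * g) ?_ ?_ ?_ ?_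
  · intro t ht
    simp only [Finset.mem_filter, Finset.mem_univ, true_and]
    exact ⟨t, by simpa using ht, rfl⟩
  · intro a _ b _ h
    exact mul_right_cancel h
  · intro h hh
    simp only [Finset.mem_filter, Finset.mem_univ, true_and] at hh
    obtain ⟨t, ht, rfl⟩ := hh
    exact ⟨t, by simpa using ht, rfl⟩
  · intros; rfl

/-- The two roots of `X² - p X - q` are not integers, so neither is an eigenvalue of `s`; hence
`s² - p s - q` has trivial kernel. -/
theorem IntegralSpectrum.eq_zero {s : MonoidAlgebra ℂ G} (hs : IntegralSpectrum s) (p q : ℤ)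
    (hpq : ∀ n : ℤ, n ^ 2 ≠ p * n + q) {w : MonoidAlgebra ℂ G}
    (hw : s * (s * w) = (p : ℂ) • (s * w) + (q : ℂ) • w) : w = 0 := by
  have root : ∀ (μ : ℂ), μ ^ 2 = p * μ + q → ∀ v, s * v = μ • v → v = 0 := by
    intro μ hμ v hv
    by_contra h0
    obtain ⟨n, rfl⟩ := hs μ v h0 hv
    exact hpq n (by exact_mod_cast hμ)
  obtain ⟨d, hd⟩ := IsAlgClosed.exists_pow_nat_eq ((p : ℂ) ^ 2 + 4 * q) (n := 2) (by norm_num)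
  have h1 : s * w - ((p - d) / 2) • w = 0 := by
    refine root ((p + d) / 2) (by linear_combination hd / 4) _ ?_
    rw [mul_sub, hw, mul_smul_comm, smul_sub, smul_smul]
    have : (q : ℂ) = - ((p + d) / 2 * ((p - d) / 2)) := by linear_combination -hd / 4
    rw [this]
    module
  exact root ((p - d) / 2) (by linear_combination hd / 4) w (sub_eq_zero.mp h1)

theorem IntegralSpectrum.two_mul {s : MonoidAlgebra ℂ G} (hs : IntegralSpectrum s) :
    IntegralSpectrum (2 * s) := by
  intro μ w hw h
  obtain ⟨n, hn⟩ := hs (μ / 2) w hw (by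
    rw [div_eq_inv_mul, mul_smul, ← h, mul_assoc, _root_.two_mul, ← two_smul ℂ, smul_smul]
    norm_num)
  exact ⟨2 * n, by push_cast; rw [← hn]; ring⟩

theorem coeff_sum_map_of [DecidableEq G] (L : List G) (g : G) :
    ((L.map (MonoidAlgebra.of ℂ G)).sum).coeff g = L.count g := by
  induction L with
  | nil => simp
  | cons a L ih =>
    simp [ih, MonoidAlgebra.of_apply, Finsupp.single_apply, List.count_cons, add_comm]

/-- If `1` occurs among the terms with sign `+` and not among those with sign `-`, then the
coefficient of `1` is positive. -/
theorem sum_sub_sum_ne_zero (P N : List G) (hP : (1 : G) ∈ P) (hN : (1 : G) ∉ N) :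
    (P.map (MonoidAlgebra.of ℂ G)).sum - (N.map (MonoidAlgebra.of ℂ G)).sum ≠ 0 := by
  classical
  intro h
  have h1 := congrArg (fun v => v.coeff (1 : G)) h
  simp only [MonoidAlgebra.coeff_sub, Finsupp.sub_apply, coeff_sum_map_of,
    List.count_eq_zero_of_not_mem hN, MonoidAlgebra.coeff_zero, Finsupp.zero_apply, Nat.cast_zero,
    sub_zero, Nat.cast_eq_zero] at h1
  exact (List.count_pos_iff.mpr hP).ne' h1

/-- On the cyclic group generated by `g`, of order `n`, the element `g + g⁻¹` has the eigenvalue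
`ζ + ζ⁻¹` for a primitive `n`-th root of unity `ζ`. It is an integer only for
`n ∈ {1, 2, 3, 4, 6}`. -/
theorem InCayleyClass.pow_four_or_pow_six [Fintype G] {k : ℕ} (hk : 2 ≤ k)
    (hG : InCayleyClass k G) (g : G) : g ^ 4 = 1 ∨ g ^ 6 = 1 := by
  classical
  by_cases hg : g ^ 2 = 1
  · left
    rw [show 4 = 2 * 2 from rfl, pow_mul, hg, one_pow]
  have hgg : g ≠ g⁻¹ := fun h => hg (by rw [pow_two]; nth_rw 1 [h]; simp)
  have hg1 : g ≠ 1 := fun h => hg (by simp [h])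
  have hs := hG.integralSpectrum [g, g⁻¹] (by simpa using hgg) (by simpa using hk) (by simp)
    (by simpa [eq_comm] using hg1)
  set n := orderOf g with hn
  have hn0 : 0 < n := orderOf_pos g
  set ζ := Complex.exp (2 * Real.pi * Complex.I / n) with hζdef
  have hζ : IsPrimitiveRoot ζ n := Complex.isPrimitiveRoot_exp n hn0.ne'
  have hζ0 : ζ ≠ 0 := Complex.exp_ne_zero _
  let δ := MonoidAlgebra.of ℂ G
  let w : MonoidAlgebra ℂ G := ∑ i ∈ Finset.range n, (ζ⁻¹ ^ i) • δ (g ^ i)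
  have hgw : δ g * w = ζ • w := by
    have h1 : ζ⁻¹ • (δ g * w) = ∑ i ∈ Finset.range n, (ζ⁻¹ ^ (i + 1)) • δ (g ^ (i + 1)) := by
      simp only [w, Finset.mul_sum, Finset.smul_sum, mul_smul_comm, smul_smul, ← map_mul]
      refine Finset.sum_congr rfl fun i _ => ?_
      rw [pow_succ', pow_succ' g]
    have h2 : ∑ i ∈ Finset.range n, (ζ⁻¹ ^ (i + 1)) • δ (g ^ (i + 1)) = w := by
      have h3 := Finset.sum_range_succ' (fun i => (ζ⁻¹ ^ i) • δ (g ^ i)) n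
      rw [Finset.sum_range_succ] at h3
      rw [inv_pow _ n, hζ.pow_eq_one, hn, pow_orderOf_eq_one] at h3
      simpa [w] using h3.symm
    rw [h2] at h1
    calc δ g * w = ζ • ζ⁻¹ • (δ g * w) := by rw [smul_smul, mul_inv_cancel₀ hζ0, one_smul]
      _ = ζ • w := by rw [h1]
  have hgw' : δ g⁻¹ * w = ζ⁻¹ • w := by
    have : δ g⁻¹ * (δ g * w) = w := by rw [← mul_assoc, ← map_mul]; simp
    rw [hgw, mul_smul_comm] at this
    rw [← smul_right_injective _ hζ0 |>.eq_iff]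
    simp only [this, smul_smul, mul_inv_cancel₀ hζ0, one_smul]
  have hw0 : w ≠ 0 := by
    intro h
    have h1 := congrArg (fun v => v.coeff (1 : G)) h
    have h2 : w.coeff 1 = ∑ i ∈ Finset.range n, if g ^ i = 1 then ζ⁻¹ ^ i else 0 := by
      simp only [w, δ, MonoidAlgebra.coeff_sum, Finsupp.finsetSum_apply]
      refine Finset.sum_congr rfl fun i _ => ?_
      simp [MonoidAlgebra.of_apply, Finsupp.single_apply]
    rw [h2, Finset.sum_eq_single 0] at h1
    · simp at h1
    · intro i hi hi0
      rw [if_neg]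
      intro h
      exact hi0 (Nat.eq_zero_of_dvd_of_lt (orderOf_dvd_of_pow_eq_one h) (Finset.mem_range.mp hi))
    · intro h
      simp [hn0.ne'] at h
  obtain ⟨m, hm⟩ := hs (ζ + ζ⁻¹) w hw0 (by
    simp only [List.map_cons, List.map_nil, List.sum_cons, List.sum_nil, add_zero, add_mul,
      add_smul]
    exact congrArg₂ _ hgw hgw')
  have hnorm : ‖ζ‖ = 1 := hζ.norm'_eq_one hn0.ne'
  have hle : |(m : ℝ)| ≤ 2 := by
    have : ‖(m : ℂ)‖ ≤ 2 := by
      rw [← hm]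
      refine (norm_add_le _ _).trans ?_
      rw [norm_inv, hnorm]; norm_num
    simpa using this
  have hle' : |m| ≤ 2 := by exact_mod_cast hle
  have hq : ζ ^ 2 = m * ζ - 1 := by
    rw [← hm]; field_simp; ring
  have key : ζ ^ 4 = 1 ∨ ζ ^ 6 = 1 := by
    obtain ⟨hl, hu⟩ := abs_le.mp hle'
    interval_cases m
    · right
      have : ζ + 1 = 0 := by
        apply pow_eq_zero_iff (n := 2) (by norm_num) |>.mp
        push_cast at hq; linear_combination hq
      rw [eq_neg_of_add_eq_zero_left this]; norm_num
    · right
      push_cast at hq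
      linear_combination (ζ - 1) * (ζ ^ 3 + 1) * hq
    · left
      push_cast at hq
      linear_combination (ζ ^ 2 - 1) * hq
    · right
      push_cast at hq
      linear_combination (ζ + 1) * (ζ ^ 3 - 1) * hq
    · right
      have : ζ - 1 = 0 := by
        apply pow_eq_zero_iff (n := 2) (by norm_num) |>.mp
        push_cast at hq; linear_combination hq
      rw [sub_eq_zero.mp this]; norm_num
  rcases key with h | h
  · exact Or.inl (orderOf_dvd_iff_pow_eq_one.mp (hζ.dvd_of_pow_eq_one 4 h))
  · exact Or.inr (orderOf_dvd_iff_pow_eq_one.mp (hζ.dvd_of_pow_eq_one 6 h))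

end GroupAlgebra

/-! ### Configurations with irrational eigenvalues -/

section Configurations

variable {G : Type*} [Group G]

/-- If `r = u v` has order four or six modulo `⟨z⟩`, then the spectrum of `(1 + z) (u + v)` contains
`√8` or `√12`. -/
theorem sq_or_cube_of_integralSpectrum {z u v : G}
    (hs : IntegralSpectrum (([u, z * u, v, z * v].map (MonoidAlgebra.of ℂ G)).sum))
    (hu : u * u = z) (hv : v * v = z) (hz : z * z = 1)
    (hr : (u * v) ^ 4 = 1 ∨ (u * v) ^ 6 = 1) :
    ((u * v) ^ 2 = 1 ∨ (u * v) ^ 2 = z) ∨ ((u * v) ^ 3 = 1 ∨ (u * v) ^ 3 = z) := by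
  by_contra! hcon
  obtain ⟨⟨h21, h2z⟩, h31, h3z⟩ := hcon
  set r := u * v with hrdef
  have hzu : u * z = z * u := by rw [← hu, mul_assoc]
  have hzv : v * z = z * v := by rw [← hv, mul_assoc]
  have hzr : Commute r z := by
    change u * v * z = z * (u * v)
    rw [mul_assoc, hzv, ← mul_assoc, hzu, mul_assoc]
  have hr' : v * u = r⁻¹ := by
    rw [eq_inv_iff_mul_eq_one, hrdef]
    calc v * u * (u * v) = v * (u * u) * v := by simp only [mul_assoc]
      _ = z * (v * v) := by rw [hu, hzv, mul_assoc]
      _ = 1 := by rw [hv, hz]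
  let δ := MonoidAlgebra.of ℂ G
  have dZZ : δ z * δ z = 1 := by rw [← map_mul, hz, map_one]
  have dU : δ u * δ u = δ z := by rw [← map_mul, hu]
  have dV : δ v * δ v = δ z := by rw [← map_mul, hv]
  have dR : δ u * δ v = δ r := by rw [← map_mul]
  have dR' : δ v * δ u = δ r⁻¹ := by rw [← map_mul, hr']
  have dZU : δ z * δ u = δ u * δ z := by rw [← map_mul, ← map_mul, hzu]
  have dZV : δ z * δ v = δ v * δ z := by rw [← map_mul, ← map_mul, hzv]
  have dZR : δ z * δ r = δ r * δ z := by rw [← map_mul, ← map_mul, hzr.eq]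
  set s := ([u, z * u, v, z * v].map (MonoidAlgebra.of ℂ G)).sum with hsdef
  have hs1 : s = δ u + δ z * δ u + δ v + δ z * δ v := by
    simp only [hsdef, List.map_cons, List.map_nil, List.sum_cons, List.sum_nil, map_mul, δ]
    abel
  have step : ∀ w, δ z * w = w → s * w = 2 * (δ u * w + δ v * w) := by
    intro w hw
    rw [hs1]
    simp only [add_mul, dZU, dZV, mul_assoc, hw]
    noncomm_ring
  have sq : ∀ w, δ z * w = w → s * (s * w) = 4 * (2 * w + (δ r + δ r⁻¹) * w) := by
    intro w hw
    have h1 : δ z * (2 * (δ u * w + δ v * w)) = 2 * (δ u * w + δ v * w) := by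
      have a1 : δ z * (δ u * w) = δ u * w := by rw [← mul_assoc, dZU, mul_assoc, hw]
      have a2 : δ z * (δ v * w) = δ v * w := by rw [← mul_assoc, dZV, mul_assoc, hw]
      calc δ z * (2 * (δ u * w + δ v * w)) = 2 * (δ z * (δ u * w) + δ z * (δ v * w)) := by
            noncomm_ring
        _ = _ := by rw [a1, a2]
    rw [step w hw, step _ h1, ← dR, ← dR']
    calc _ = 4 * ((δ u * δ u) * w + (δ v * δ v) * w + (δ u * δ v + δ v * δ u) * w) := by
          noncomm_ring
      _ = _ := by rw [dU, dV, hw]; noncomm_ring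
  have hN : δ z * (1 + δ z) = 1 + δ z := by rw [mul_add, dZZ, mul_one, add_comm]
  have fix : ∀ y, δ z * y = y * δ z → δ z * (y * (1 + δ z)) = y * (1 + δ z) := by
    intro y hy
    rw [← mul_assoc, hy, mul_assoc, hN]
  have cZ : Commute (δ z) (δ r) := dZR
  rcases hr with h4 | h6
  · -- `r` has order four modulo `⟨z⟩`, so `r + r⁻¹` vanishes on `1 - r²` and `s² = 8` there.
    have d4 : δ r ^ 4 = 1 := by rw [← map_pow, h4, map_one]
    have hinv : δ r⁻¹ = δ r ^ 3 := by
      rw [← map_pow]; congr 1; rw [inv_eq_iff_mul_eq_one, ← pow_succ', h4]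
    have hw0 : (1 - δ r ^ 2) * (1 + δ z) = 0 := by
      refine hs.eq_zero 0 8 ?_ ?_
      · intro n hn
        have : n ^ 2 = 8 := by linarith
        have h3 : n ≤ 2 := by nlinarith
        have h3' : -2 ≤ n := by nlinarith
        interval_cases n <;> omega
      · rw [sq _ (fix _ ?_), hinv]
        · have : (δ r + δ r ^ 3) * ((1 - δ r ^ 2) * (1 + δ z))
              = (δ r - δ r ^ 4 * δ r) * (1 + δ z) := by noncomm_ring
          rw [this, d4]
          simp only [Int.cast_zero, zero_smul, Int.cast_ofNat, ofNat_smul_eq_nsmul]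
          noncomm_ring
        · exact ((Commute.one_right _).sub_right (cZ.pow_right 2)).eq
    refine sum_sub_sum_ne_zero [1, z] [r ^ 2, r ^ 2 * z] (by simp) ?_ ?_
    · simp only [List.mem_cons, List.not_mem_nil, or_false, not_or]
      refine ⟨fun h => h21 h.symm, fun h => h2z ?_⟩
      rw [eq_comm, ← eq_inv_iff_mul_eq_one] at h
      rw [h, inv_eq_iff_mul_eq_one, hz]
    · rw [← hw0]
      simp only [List.map_cons, List.map_nil, List.sum_cons, List.sum_nil, map_mul, map_pow,
        map_one]
      noncomm_ring
  · -- `r` has order six modulo `⟨z⟩`, so `r + r⁻¹ = 1` on `(1 + r) (1 - r³)`, and `s² = 12` there.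
    have d6 : δ r ^ 6 = 1 := by rw [← map_pow, h6, map_one]
    have hinv : δ r⁻¹ = δ r ^ 5 := by
      rw [← map_pow]; congr 1; rw [inv_eq_iff_mul_eq_one, ← pow_succ', h6]
    have hw0 : ((1 + δ r) * (1 - δ r ^ 3)) * (1 + δ z) = 0 := by
      refine hs.eq_zero 0 12 ?_ ?_
      · intro n hn
        have : n ^ 2 = 12 := by linarith
        have h3 : n ≤ 3 := by nlinarith
        have h3' : -3 ≤ n := by nlinarith
        interval_cases n <;> omega
      · rw [sq _ (fix _ ?_), hinv]
        · have : (δ r + δ r ^ 5) * (((1 + δ r) * (1 - δ r ^ 3)) * (1 + δ z))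
              = (δ r + δ r ^ 2 - δ r ^ 4 - δ r ^ 5
                + δ r ^ 5 + δ r ^ 6 - δ r ^ 6 * δ r ^ 2 - δ r ^ 6 * δ r ^ 3) * (1 + δ z) := by
            noncomm_ring
          rw [this, d6]
          simp only [Int.cast_zero, zero_smul, Int.cast_ofNat, ofNat_smul_eq_nsmul]
          noncomm_ring
        · exact (((Commute.one_right _).add_right cZ).mul_right
            ((Commute.one_right _).sub_right (cZ.pow_right 3))).eq
    have h41 : r ^ 4 ≠ 1 := fun h => h21 (by
      calc r ^ 2 = r ^ 4 * r ^ 2 := by rw [h, one_mul]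
        _ = 1 := by rw [← pow_add, h6])
    have hinvz : ∀ g : G, g * z = 1 → g = z := by
      intro g h
      rw [← eq_inv_iff_mul_eq_one] at h
      rw [h, inv_eq_iff_mul_eq_one, hz]
    refine sum_sub_sum_ne_zero [1, z, r, r * z] [r ^ 3, r ^ 3 * z, r ^ 4, r ^ 4 * z] (by simp) ?_ ?_
    · simp only [List.mem_cons, List.not_mem_nil, or_false, not_or]
      refine ⟨fun h => h31 h.symm, fun h => h3z (hinvz _ h.symm), fun h => h41 h.symm,
        fun h => h2z ?_⟩
      have h4 := hinvz _ h.symm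
      have h5 : z * r ^ 2 = 1 := by rw [← h4, ← pow_add, h6]
      rw [← inv_eq_iff_mul_eq_one] at h5
      rw [← h5, inv_eq_iff_mul_eq_one, hz]
    · rw [← hw0]
      simp only [List.map_cons, List.map_nil, List.sum_cons, List.sum_nil, map_mul, map_pow,
        map_one]
      noncomm_ring

/-- Two elements `u`, `v` with the same square `z`, where `z² = 1`, are involutions modulo `⟨z⟩`;
they generate there a dihedral group of order at most six. Both the case of involutions (`z = 1`)
and that of elements of order four are covered. -/
theorem InCayleyClass.sq_or_cube_mul [Fintype G] (hG : InCayleyClass 4 G) {z u v : G}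
    (hu : u * u = z) (hv : v * v = z) (hz : z * z = 1) :
    ((u * v) ^ 2 = 1 ∨ (u * v) ^ 2 = z) ∨ ((u * v) ^ 3 = 1 ∨ (u * v) ^ 3 = z) := by
  classical
  have hzu : u * z = z * u := by rw [← hu, mul_assoc]
  by_cases huv : u = v
  · left; left
    rw [← huv, hu, pow_two, hz]
  by_cases huv' : z * u = v
  · left; left
    rw [← huv', ← mul_assoc, hzu, mul_assoc, hu, hz, one_pow]
  have hord := hG.pow_four_or_pow_six (by norm_num) (u * v)
  have hui : u⁻¹ = z * u := by
    rw [inv_eq_iff_mul_eq_one, ← mul_assoc, hzu, mul_assoc, hu, hz]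
  have hvi : v⁻¹ = z * v := by
    rw [inv_eq_iff_mul_eq_one, ← hv, ← mul_assoc, ← mul_assoc, hv, mul_assoc, hv, hz]
  by_cases hz1 : z = 1
  · subst hz1
    rw [one_mul] at hui hvi
    by_cases hu1 : u = 1
    · left; left
      rw [hu1, one_mul, pow_two, hv]
    by_cases hv1 : v = 1
    · left; left
      rw [hv1, mul_one, pow_two, hu]
    refine sq_or_cube_of_integralSpectrum ?_ hu hv hz hord
    have := (hG.integralSpectrum [u, v] (by simpa using huv) (by simp)
      (by simp [hui, hvi]) (by simp [eq_comm, hu1, hv1])).two_mul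
    convert this using 1
    simp only [List.map_cons, List.map_nil, List.sum_cons, List.sum_nil, one_mul]
    noncomm_ring
  · have hu1 : u ≠ 1 := fun h => hz1 (by rw [← hu, h, one_mul])
    have hv1 : v ≠ 1 := fun h => hz1 (by rw [← hv, h, one_mul])
    refine sq_or_cube_of_integralSpectrum (hG.integralSpectrum _ ?_ (by simp) ?_ ?_) hu hv hz hord
    · have h1 : u ≠ z * v := fun h => huv' (by rw [h, ← mul_assoc, hz, one_mul])
      simp [huv, huv', h1, hz1]
    · rw [← hui, ← hvi]; simp
    · rw [← hui, ← hvi]; simp [eq_comm, hu1, hv1]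

/-- The alternating group `A₄`, generated by `α`, `β` and the element `x` of order three, is not in
the class: the spectrum of `α + β + x + x⁻¹` contains the roots of `X² + X - 4`. -/
theorem InCayleyClass.eq_one_of_alternating [Fintype G] (hG : InCayleyClass 4 G) {α β x : G}
    (hα : α * α = 1) (hβ : x * α * x⁻¹ = β) (hαβ : x * β * x⁻¹ = α * β) (hcomm : β * α = α * β)
    (hx : x ^ 3 = 1) : α = 1 := by
  classical
  by_contra hα1
  have hββ : β * β = 1 := by
    rw [← hβ]
    calc x * α * x⁻¹ * (x * α * x⁻¹) = x * (α * α) * x⁻¹ := by group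
      _ = 1 := by rw [hα]; group
  have hβ1 : β ≠ 1 := by
    intro h
    rw [h] at hβ
    exact hα1 (conj_eq_one_iff.mp hβ)
  have hne : α ≠ β := by
    intro h
    rw [← h, hα] at hαβ
    exact hα1 (conj_eq_one_iff.mp hαβ)
  have hx1 : x ≠ 1 := by
    rintro rfl
    exact hne (by simpa using hβ)
  have hxi : x⁻¹ = x * x := by rw [inv_eq_iff_mul_eq_one, ← pow_two, ← pow_succ', hx]
  have hsq : ∀ g : G, g * g = 1 → x ≠ g := by
    rintro g hg rfl
    rw [pow_succ, pow_two, hg, one_mul] at hx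
    exact hx1 hx
  have hsq' : ∀ g : G, g * g = 1 → g ≠ x⁻¹ := by
    intro g hg h
    refine hsq (g⁻¹) ?_ ?_
    · rw [← mul_inv_rev, hg, inv_one]
    · rw [h, inv_inv]
  have hxx : x ≠ x⁻¹ := fun h => hsq x (by nth_rw 2 [h]; simp) rfl
  have hs := hG.integralSpectrum [α, β, x, x⁻¹]
    (by simp [hne, hxx, hsq' α hα, hsq' β hββ, (hsq α hα).symm, (hsq β hββ).symm]) (by simp)
    (by simp [inv_eq_of_mul_eq_one_right hα, inv_eq_of_mul_eq_one_right hββ])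
    (by simp [eq_comm, hα1, hβ1, hx1])
  let δ := MonoidAlgebra.of ℂ G
  have dAA : δ α * δ α = 1 := by rw [← map_mul, hα, map_one]
  have dBB : δ β * δ β = 1 := by rw [← map_mul, hββ, map_one]
  have dBA : δ β * δ α = δ α * δ β := by rw [← map_mul, ← map_mul, hcomm]
  have dX : δ x * (δ x * δ x) = 1 := by
    rw [← map_mul, ← map_mul, ← hxi, mul_inv_cancel, map_one]
  have dBX : δ β * δ x = δ x * δ α := by
    rw [← map_mul, ← map_mul, ← hβ]; congr 1; group
  have dAX : δ α * δ x = δ x * (δ α * δ β) := by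
    rw [← map_mul, ← map_mul, ← map_mul, ← hαβ]; congr 1
    calc α * x = (β * β) * α * x := by rw [hββ, one_mul]
      _ = β * (α * β) * x := by rw [mul_assoc β β α, hcomm]
      _ = (x * α * x⁻¹) * (x * β * x⁻¹) * x := by rw [hβ, hαβ]
      _ = x * (α * β) := by group
      _ = x * (x * β * x⁻¹) := by rw [hαβ]
  set v := 1 + δ α * δ β - (δ α + δ β) with hv
  have rA : δ α * v = -v := by
    rw [hv, mul_sub, mul_add, mul_add, ← mul_assoc, dAA]; noncomm_ring
  have rB : δ β * v = -v := by
    rw [hv, mul_sub, mul_add, mul_add, ← mul_assoc, dBA, mul_assoc, dBB]; noncomm_ring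
  have cA : δ α * (δ x * v) = δ x * v := by
    rw [← mul_assoc, dAX, mul_assoc, mul_assoc, rB, mul_neg, rA, neg_neg]
  have cB : δ β * (δ x * v) = -(δ x * v) := by
    rw [← mul_assoc, dBX, mul_assoc, rA, mul_neg]
  have eA : δ α * (δ x * (δ x * v)) = -(δ x * (δ x * v)) := by
    rw [← mul_assoc, dAX, mul_assoc, mul_assoc, cB, mul_neg, cA, mul_neg]
  have eB : δ β * (δ x * (δ x * v)) = δ x * (δ x * v) := by
    rw [← mul_assoc, dBX, mul_assoc, cA]
  have eX : δ x * (δ x * (δ x * v)) = v := by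
    rw [← mul_assoc (δ x) (δ x) v, ← mul_assoc, dX, one_mul]
  have hv0 : v = 0 := by
    refine hs.eq_zero (-1) 4 ?_ ?_
    · intro n hn
      have h3 : n ≤ 2 := by nlinarith
      have h3' : -3 ≤ n := by nlinarith
      interval_cases n <;> omega
    · have hs1 : ([α, β, x, x⁻¹].map (MonoidAlgebra.of ℂ G)).sum
          = δ α + δ β + δ x + δ x * δ x := by
        rw [hxi]
        simp only [List.map_cons, List.map_nil, List.sum_cons, List.sum_nil, map_mul, δ]
        abel
      rw [hs1]
      have s1 : (δ α + δ β + δ x + δ x * δ x) * v = -2 * v + (δ x * v + δ x * (δ x * v)) := by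
        simp only [add_mul, rA, rB, mul_assoc]; noncomm_ring
      have s2 : (δ α + δ β + δ x + δ x * δ x) * (δ x * v + δ x * (δ x * v))
          = (δ x * v + δ x * (δ x * v)) + 2 * v := by
        simp only [add_mul, mul_add, mul_assoc, cA, cB, eA, eB, eX]; noncomm_ring
      have s3 : (δ α + δ β + δ x + δ x * δ x) * (-2 * v + (δ x * v + δ x * (δ x * v)))
          = -2 * ((δ α + δ β + δ x + δ x * δ x) * v)
            + (δ α + δ β + δ x + δ x * δ x) * (δ x * v + δ x * (δ x * v)) := by
        noncomm_ring
      rw [s1, s3, s1, s2]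
      simp only [Int.cast_neg, Int.cast_one, neg_smul, one_smul, Int.cast_ofNat,
        ofNat_smul_eq_nsmul]
      noncomm_ring
  refine sum_sub_sum_ne_zero [1, α * β] [α, β] (by simp) (by simp [eq_comm, hα1, hβ1]) ?_
  rw [← hv0, hv]
  simp only [List.map_cons, List.map_nil, List.sum_cons, List.sum_nil, map_mul, map_one]
  change 1 + (δ α * δ β + 0) - (δ α + (δ β + 0)) = _
  simp only [add_zero]

/-- The group `SL(2, 3)`, generated by a quaternion group `⟨α, β⟩` with centre `⟨z⟩` and the element
`x` of order three, is not in the class: modulo `⟨z⟩` it is `A₄`, and the spectrum of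
`α + α⁻¹ + x + x⁻¹` contains the roots of `X² - X - 4`. -/
theorem InCayleyClass.eq_one_of_binaryTetrahedral [Fintype G] (hG : InCayleyClass 4 G)
    {z α β x : G} (hα : α * α = z) (hz : z * z = 1) (hzx : x * z = z * x)
    (hβ : x * α * x⁻¹ = β)
    (hαβ : x * β * x⁻¹ = α * β ∨ x * β * x⁻¹ = α * β * z)
    (hcomm : β * α = α * β ∨ β * α = α * β * z) (hx : x ^ 3 = 1) : z = 1 := by
  classical
  by_contra hz1
  have hzα : α * z = z * α := by rw [← hα, mul_assoc]
  have hββ : β * β = z := by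
    rw [← hβ]
    calc x * α * x⁻¹ * (x * α * x⁻¹) = x * (α * α) * x⁻¹ := by group
      _ = z := by rw [hα, hzx]; group
  have hzβ : β * z = z * β := by rw [← hββ, mul_assoc]
  have hα1 : α ≠ 1 := by rintro rfl; exact hz1 (by simpa using hα.symm)
  have hβz : β ≠ 1 ∧ β ≠ z := by
    constructor
    · rintro rfl; exact hz1 (by simpa using hββ.symm)
    · rintro rfl; exact hz1 (by rw [← hββ, hz])
  have hαβ1 : α * β ≠ 1 ∧ α * β ≠ z := by
    have h1 : ¬ (x * β * x⁻¹ = 1 ∨ x * β * x⁻¹ = z) := by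
      rintro (h | h)
      · exact hβz.1 (conj_eq_one_iff.mp h)
      · refine hβz.2 ?_
        have : β = x⁻¹ * z * x := by rw [← h]; group
        rw [this, mul_assoc, ← hzx]; group
    constructor
    · intro h
      rw [h, one_mul] at hαβ
      exact h1 hαβ
    · intro h
      rw [h, hz] at hαβ
      exact h1 hαβ.symm
  have hx1 : x ≠ 1 := by
    rintro rfl
    rw [one_mul, inv_one, mul_one] at hβ
    rw [one_mul, inv_one, mul_one, ← hβ, hα, hz] at hαβ
    rcases hαβ with h | h
    · exact hβz.2 (by rw [← hβ, h])
    · exact hα1 h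
  have hxi : x⁻¹ = x * x := by rw [inv_eq_iff_mul_eq_one, ← pow_two, ← pow_succ', hx]
  have hαi : α⁻¹ = z * α := by rw [inv_eq_iff_mul_eq_one, ← mul_assoc, hzα, mul_assoc, hα, hz]
  have hxx : x ≠ x⁻¹ := by
    intro h
    have : x * x = 1 := by nth_rw 2 [h]; simp
    rw [pow_succ, pow_two, this, one_mul] at hx
    exact hx1 hx
  have hαα : α ≠ α⁻¹ := by
    intro h
    exact hz1 (by rw [← hα]; nth_rw 2 [h]; simp)
  have hαx : α ≠ x := by
    rintro rfl
    have h1 : α = β := by rw [← hβ]; group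
    rw [← h1] at hαβ hβz
    rw [mul_inv_cancel_right, hα, hz] at hαβ
    rcases hαβ with h | h
    · exact hβz.2 h
    · exact hβz.1 h
  have hαx' : α ≠ x⁻¹ := by
    rintro rfl
    have h1 : x⁻¹ = β := by rw [← hβ]; group
    rw [← h1] at hαβ hβz
    rw [mul_inv_cancel, one_mul, hα, hz] at hαβ
    rcases hαβ with h | h
    · exact hβz.2 h
    · exact hβz.1 h
  have hs := hG.integralSpectrum [α, α⁻¹, x, x⁻¹]
    (by
      have h1 : α⁻¹ ≠ x := fun h => hαx' (by rw [← h, inv_inv])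
      simp [hxx, hαα, hαx, hαx', h1]) (by simp)
    (by simp) (by simp [eq_comm, hα1, hx1])
  let δ := MonoidAlgebra.of ℂ G
  have dZZ : δ z * δ z = 1 := by rw [← map_mul, hz, map_one]
  have dAA : δ α * δ α = δ z := by rw [← map_mul, hα]
  have dBB : δ β * δ β = δ z := by rw [← map_mul, hββ]
  have dZA : δ z * δ α = δ α * δ z := by rw [← map_mul, ← map_mul, hzα]
  have dZB : δ z * δ β = δ β * δ z := by rw [← map_mul, ← map_mul, hzβ]
  have dZX : δ z * δ x = δ x * δ z := by rw [← map_mul, ← map_mul, hzx]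
  have dX : δ x * (δ x * δ x) = 1 := by
    rw [← map_mul, ← map_mul, ← hxi, mul_inv_cancel, map_one]
  have dBX : δ β * δ x = δ x * δ α := by
    rw [← map_mul, ← map_mul, ← hβ]; congr 1; group
  -- All computations take place in the left ideal of the elements fixed by `z`, which is stable
  -- under `α`, `β` and `x`.
  have fA : ∀ y, δ z * y = y → δ z * (δ α * y) = δ α * y := by
    intro y hy; rw [← mul_assoc, dZA, mul_assoc, hy]
  have fB : ∀ y, δ z * y = y → δ z * (δ β * y) = δ β * y := by
    intro y hy; rw [← mul_assoc, dZB, mul_assoc, hy]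
  have fX : ∀ y, δ z * y = y → δ z * (δ x * y) = δ x * y := by
    intro y hy; rw [← mul_assoc, dZX, mul_assoc, hy]
  have fBA : ∀ y, δ z * y = y → δ β * (δ α * y) = δ α * (δ β * y) := by
    intro y hy
    rw [← mul_assoc, ← map_mul]
    rcases hcomm with h | h
    · rw [h, map_mul, mul_assoc]
    · rw [h, map_mul, map_mul, mul_assoc, mul_assoc, hy]
  have fAX : ∀ y, δ z * y = y → δ α * (δ x * y) = δ x * (δ α * (δ β * y)) := by
    intro y hy
    have key : α * x = x * (α * β) ∨ α * x = x * (α * β) * z := by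
      have h3 : x * (x * β * x⁻¹) * x⁻¹ = α := by
        calc x * (x * β * x⁻¹) * x⁻¹ = x * (x * (x * α * x⁻¹) * x⁻¹) * x⁻¹ := by rw [hβ]
          _ = x ^ 3 * α * (x ^ 3)⁻¹ := by
            simp only [pow_succ, pow_zero, one_mul, mul_inv_rev, mul_assoc]
          _ = α := by rw [hx]; group
      have h4 : α * x = x * (x * β * x⁻¹) := by nth_rw 1 [← h3]; group
      rw [h4]
      rcases hαβ with h | h
      · left; rw [h]
      · right; rw [h, ← mul_assoc]
    rw [← mul_assoc, ← map_mul]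
    rcases key with h | h
    · rw [h, map_mul, map_mul, mul_assoc, mul_assoc]
    · rw [h, map_mul, map_mul, map_mul, mul_assoc, mul_assoc, mul_assoc, hy]
  have hN : δ z * (1 + δ z) = 1 + δ z := by rw [mul_add, dZZ, mul_one, add_comm]
  set e := (1 + δ z) with he
  have hM : δ z * (e - δ β * e) = e - δ β * e := by rw [mul_sub, hN, fB _ hN]
  set v := (e - δ β * e) + δ α * (e - δ β * e) with hv
  have fv : δ z * v = v := by rw [hv, mul_add, hM, fA _ hM]
  have rA : δ α * v = v := by
    rw [hv, mul_add, ← mul_assoc (δ α) (δ α), dAA, hM, add_comm]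
  have rB : δ β * v = -v := by
    have : δ β * (e - δ β * e) = -(e - δ β * e) := by
      rw [mul_sub, ← mul_assoc, dBB, hN]; abel
    rw [hv, mul_add, fBA _ hM, this, mul_neg]; abel
  have cA : δ α * (δ x * v) = -(δ x * v) := by
    rw [fAX _ fv, rB, mul_neg, rA, mul_neg]
  have cB : δ β * (δ x * v) = δ x * v := by
    rw [← mul_assoc, dBX, mul_assoc, rA]
  have eA : δ α * (δ x * (δ x * v)) = -(δ x * (δ x * v)) := by
    rw [fAX _ (fX _ fv), cB, cA, mul_neg]
  have eX : δ x * (δ x * (δ x * v)) = v := by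
    rw [← mul_assoc (δ x) (δ x) v, ← mul_assoc, dX, one_mul]
  have hv0 : v = 0 := by
    refine hs.eq_zero 1 4 ?_ ?_
    · intro n hn
      have h3 : n ≤ 3 := by nlinarith
      have h3' : -2 ≤ n := by nlinarith
      interval_cases n <;> omega
    · have hs1 : ([α, α⁻¹, x, x⁻¹].map (MonoidAlgebra.of ℂ G)).sum
          = δ α + δ z * δ α + δ x + δ x * δ x := by
        rw [hxi, hαi]
        simp only [List.map_cons, List.map_nil, List.sum_cons, List.sum_nil, map_mul, δ]
        abel
      rw [hs1]
      set s := δ α + δ z * δ α + δ x + δ x * δ x with hs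
      have s1 : s * v = 2 * v + (δ x * v + δ x * (δ x * v)) := by
        simp only [hs, add_mul, rA, fv, mul_assoc]; noncomm_ring
      have s2 : s * (δ x * v + δ x * (δ x * v))
          = 2 * v - (δ x * v + δ x * (δ x * v)) := by
        simp only [hs, add_mul, mul_add, mul_assoc, cA, eA, eX, mul_neg, fX _ fv, fX _ (fX _ fv)]
        noncomm_ring
      have s3 : s * (2 * v + (δ x * v + δ x * (δ x * v)))
          = 2 * (s * v) + s * (δ x * v + δ x * (δ x * v)) := by
        noncomm_ring
      rw [s1, s3, s1, s2]
      simp only [Int.cast_one, one_smul, Int.cast_ofNat, ofNat_smul_eq_nsmul]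
      noncomm_ring
  have hinvz : ∀ g : G, g * z = 1 → g = z := by
    intro g h
    rw [← eq_inv_iff_mul_eq_one] at h
    rw [h, inv_eq_iff_mul_eq_one, hz]
  refine sum_sub_sum_ne_zero [1, z, α, α * z] [β, β * z, α * β, α * β * z] (by simp) ?_ ?_
  · simp only [List.mem_cons, List.not_mem_nil, or_false, not_or]
    exact ⟨hβz.1.symm, fun h => hβz.2 (hinvz _ h.symm), hαβ1.1.symm,
      fun h => hαβ1.2 (hinvz _ h.symm)⟩
  · rw [← hv0, hv]
    simp only [List.map_cons, List.map_nil, List.sum_cons, List.sum_nil, map_mul, map_one]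
    change 1 + (δ z + (δ α + (δ α * δ z + 0))) - (δ β + (δ β * δ z + (δ α * δ β
      + (δ α * δ β * δ z + 0)))) = _
    rw [he]
    noncomm_ring

/-- The group `S₃ × ℤ₃` is not in the class: with `a`, `b` involutions of `S₃` and `w` a generator
of `ℤ₃`, the spectrum of `a + b w + b w⁻¹` contains `√3`. -/
theorem InCayleyClass.eq_one_of_symm_prod_cyclic [Fintype G] (hG : InCayleyClass 4 G) {a b w : G}
    (ha : a * a = 1) (hb : b * b = 1) (ha1 : a ≠ 1) (hab : (a * b) ^ 3 = 1) (hne : a ≠ b)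
    (hwa : w * a = a * w) (hwb : w * b = b * w) (hw : w ^ 3 = 1) : w = 1 := by
  by_contra hw1
  have hwi : w⁻¹ = w * w := by rw [inv_eq_iff_mul_eq_one, ← pow_two, ← pow_succ', hw]
  have hww1 : w * w ≠ 1 := by rw [← hwi]; simpa using hw1
  have hsq1 : b * w * (b * w) = w * w := by
    rw [mul_assoc, ← mul_assoc w, hwb, ← mul_assoc, ← mul_assoc, hb, one_mul]
  have hsq2 : b * (w * w) * (b * (w * w)) = w := by
    rw [← hwi]
    have : w⁻¹ * b = b * w⁻¹ := (show Commute w b from hwb).inv_left.eq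
    rw [mul_assoc, ← mul_assoc w⁻¹, this, ← mul_assoc, ← mul_assoc, hb, one_mul, hwi]
    calc w * w * (w * w) = w ^ 3 * w := by simp only [pow_succ, pow_zero, one_mul, mul_assoc]
      _ = w := by rw [hw, one_mul]
  have hinv : (b * w)⁻¹ = b * (w * w) := by
    rw [inv_eq_iff_mul_eq_one, ← mul_assoc b w w, ← mul_assoc, hsq1, mul_assoc, ← hwi,
      ← mul_inv_cancel w, hwi]
  have hne1 : ∀ g : G, g * g = 1 → g ≠ b * w := by
    rintro g hg rfl
    exact hww1 (by rw [← hsq1, hg])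
  have hne2 : ∀ g : G, g * g = 1 → g ≠ b * (w * w) := by
    rintro g hg rfl
    exact hw1 (by rw [← hsq2, hg])
  have hs := hG.integralSpectrum [a, b * w, b * (w * w)]
    (by simp [hne1 a ha, hne2 a ha, hw1]) (by simp)
    (by rw [← hinv]; simp [inv_eq_of_mul_eq_one_right ha])
    (by simp only [List.mem_cons, List.not_mem_nil, or_false, not_or]
        exact ⟨ha1.symm, hne1 1 (one_mul 1), hne2 1 (one_mul 1)⟩)
  let δ := MonoidAlgebra.of ℂ G
  have dAA : δ a * δ a = 1 := by rw [← map_mul, ha, map_one]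
  have dBB : δ b * δ b = 1 := by rw [← map_mul, hb, map_one]
  have dWA : δ w * δ a = δ a * δ w := by rw [← map_mul, ← map_mul, hwa]
  have dWB : δ w * δ b = δ b * δ w := by rw [← map_mul, ← map_mul, hwb]
  have dW : δ w * (δ w * δ w) = 1 := by
    rw [← map_mul, ← map_mul, ← hwi, mul_inv_cancel, map_one]
  have dBA : δ b * δ a = δ a * (δ b * (δ a * δ b)) := by
    simp only [← map_mul]
    congr 1
    rw [← inv_eq_of_mul_eq_one_right ha, ← inv_eq_of_mul_eq_one_right hb, ← mul_inv_rev,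
      inv_eq_of_mul_eq_one_right ha, inv_eq_of_mul_eq_one_right hb, inv_eq_iff_mul_eq_one, ← hab]
    simp only [pow_succ, pow_zero, one_mul, mul_assoc]
  -- On the elements killed by `1 + w + w²`, the sum acts as `a - b`.
  have hA : ∀ y, δ w * y + δ w * (δ w * y) = -y →
      δ w * (δ a * y) + δ w * (δ w * (δ a * y)) = -(δ a * y) := by
    intro y hy
    rw [← mul_assoc (δ w) (δ a), dWA, mul_assoc, ← mul_assoc (δ w) (δ a), dWA, mul_assoc,
      ← mul_add, hy, mul_neg]
  have hB : ∀ y, δ w * y + δ w * (δ w * y) = -y →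
      δ w * (δ b * y) + δ w * (δ w * (δ b * y)) = -(δ b * y) := by
    intro y hy
    rw [← mul_assoc (δ w) (δ b), dWB, mul_assoc, ← mul_assoc (δ w) (δ b), dWB, mul_assoc,
      ← mul_add, hy, mul_neg]
  have hM : δ w * (1 - δ w) + δ w * (δ w * (1 - δ w)) = -(1 - δ w) := by
    rw [mul_sub, mul_sub, dW, mul_one]; abel
  set s := ([a, b * w, b * (w * w)].map (MonoidAlgebra.of ℂ G)).sum with hsdef
  have step : ∀ y, δ w * y + δ w * (δ w * y) = -y → s * y = δ a * y - δ b * y := by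
    intro y hy
    have hs1 : s = δ a + (δ b * δ w + δ b * (δ w * δ w)) := by
      simp only [hsdef, List.map_cons, List.map_nil, List.sum_cons, List.sum_nil, map_mul, δ,
        add_zero]
    rw [hs1, add_mul, add_mul, mul_assoc, mul_assoc, mul_assoc, ← mul_add, hy, mul_neg,
      sub_eq_add_neg]
  set v := (1 - δ w) - δ a * (δ b * (1 - δ w)) with hv
  have fv : δ w * v + δ w * (δ w * v) = -v := by
    have h1 := hA _ (hB _ hM)
    calc _ = (δ w * (1 - δ w) + δ w * (δ w * (1 - δ w)))
          - (δ w * (δ a * (δ b * (1 - δ w))) + δ w * (δ w * (δ a * (δ b * (1 - δ w))))) := by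
            rw [hv]; noncomm_ring
      _ = _ := by rw [h1, hM, hv]; abel
  have fsv : δ w * (δ a * v - δ b * v) + δ w * (δ w * (δ a * v - δ b * v))
      = -(δ a * v - δ b * v) := by
    calc _ = (δ w * (δ a * v) + δ w * (δ w * (δ a * v)))
          - (δ w * (δ b * v) + δ w * (δ w * (δ b * v))) := by noncomm_ring
      _ = _ := by rw [hA _ fv, hB _ fv]; abel
  have hv0 : v = 0 := by
    refine hs.eq_zero 0 3 ?_ ?_
    · intro n hn
      have h3 : n ≤ 2 := by nlinarith
      have h3' : -2 ≤ n := by nlinarith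
      interval_cases n <;> omega
    · have h1 : δ a * (δ b * v) + δ b * (δ a * v) = -v := by
        have e1 : δ b * (δ a * v)
            = δ b * δ a * (1 - δ w) - δ b * ((δ a * δ a) * (δ b * (1 - δ w))) := by
          rw [hv]; noncomm_ring
        have e2 : δ a * (δ b * v) = δ a * (δ b * (1 - δ w))
            - δ a * (δ b * (δ a * δ b)) * (1 - δ w) := by
          rw [hv]; noncomm_ring
        rw [e1, e2, dAA, dBA, one_mul, ← mul_assoc (δ b) (δ b), dBB, one_mul, hv]
        abel
      rw [step _ fv, step _ fsv]
      calc δ a * (δ a * v - δ b * v) - δ b * (δ a * v - δ b * v)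
          = δ a * δ a * v + δ b * δ b * v - (δ a * (δ b * v) + δ b * (δ a * v)) := by
            noncomm_ring
        _ = _ := by
          rw [h1, dAA, dBB]
          simp only [Int.cast_zero, zero_smul, Int.cast_ofNat, ofNat_smul_eq_nsmul]
          noncomm_ring
  have hab1 : a * b ≠ 1 := fun h => hne (by
    rw [← inv_eq_of_mul_eq_one_right h, inv_eq_of_mul_eq_one_right ha])
  refine sum_sub_sum_ne_zero [1, a * b * w] [a * b, w] (by simp) (by
    simpa [eq_comm, hw1] using hab1) ?_
  rw [← hv0, hv]
  simp only [List.map_cons, List.map_nil, List.sum_cons, List.sum_nil, map_mul, map_one]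
  change 1 + (δ a * δ b * δ w + 0) - (δ a * δ b + (δ w + 0)) = _
  noncomm_ring

/-! ### Groups of exponent three and three involutions -/

/-- If `x³ = y³ = 1` and `(x y)³`, `(x y⁻¹)³` lie in a central subgroup `⟨z⟩` of order at most two,
then the three conjugates of `x` under `⟨y⟩` commute and have product `1`. The order of `z` is prime
to three, so the two cubes are in fact trivial. -/
theorem commute_conj_of_cubes {x y z : G} (hz : z * z = 1) (hzx : Commute z x) (hzy : Commute z y)
    (hx : x ^ 3 = 1) (hy : y ^ 3 = 1) (h1 : (x * y) ^ 3 = 1 ∨ (x * y) ^ 3 = z)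
    (h2 : (x * y⁻¹) ^ 3 = 1 ∨ (x * y⁻¹) ^ 3 = z) :
    Commute x (y * x * y⁻¹) ∧ x * (y * x * y⁻¹) * (y * (y * x * y⁻¹) * y⁻¹) = 1 ∧
      (x * y) ^ 3 = 1 := by
  have central : ∀ e : G, e = 1 ∨ e = z → e * e = 1 ∧ Commute e x ∧ Commute e y := by
    rintro e (rfl | rfl)
    · exact ⟨one_mul 1, Commute.one_left _, Commute.one_left _⟩
    · exact ⟨hz, hzx, hzy⟩
  obtain ⟨p1, p1x, p1y⟩ := central _ h1
  obtain ⟨p2, p2x, p2y⟩ := central _ h2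
  have cube : ∀ e : G, e * e = 1 → e ^ 3 = 1 → e = 1 := by
    intro e he he3
    rwa [pow_succ, pow_two, he, one_mul] at he3
  set x1 := y * x * y⁻¹ with hx1
  set x2 := y * x1 * y⁻¹ with hx2
  have conj3 : y * x2 * y⁻¹ = x := by
    calc y * x2 * y⁻¹ = y ^ 3 * x * (y ^ 3)⁻¹ := by
          rw [hx2, hx1]; simp only [pow_succ, pow_zero, one_mul, mul_inv_rev, mul_assoc]
      _ = x := by rw [hy]; group
  have hx13 : x1 ^ 3 = 1 := by rw [hx1, conj_pow, hx]; group
  have hx23 : x2 ^ 3 = 1 := by rw [hx2, conj_pow, hx13]; group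
  have e1 : (x * y) ^ 3 = x * x1 * x2 := by
    calc (x * y) ^ 3 = x * x1 * x2 * y ^ 3 := by
          rw [hx2, hx1, pow_succ (x * y), pow_two]; group
      _ = _ := by rw [hy, mul_one]
  have e2 : (x * y⁻¹) ^ 3 = x * x2 * x1 := by
    have q2 : y⁻¹ * x * y = x2 := by nth_rw 1 [← conj3]; group
    have q1 : y⁻¹ * x2 * y = x1 := by rw [hx2]; group
    calc (x * y⁻¹) ^ 3 = x * (y⁻¹ * x * y) * (y⁻¹ * (y⁻¹ * x * y) * y) * (y ^ 3)⁻¹ := by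
          rw [pow_succ (x * y⁻¹), pow_two]; group
      _ = _ := by rw [hy, q2, q1, inv_one, mul_one]
  rw [e1] at p1 p1x p1y
  rw [e2] at p2 p2x p2y
  set c1 := x * x1 * x2 with hc1
  set c2 := x * x2 * x1 with hc2
  have p1x1 : Commute c1 x1 := (p1y.mul_right p1x).mul_right p1y.inv_right
  have p2x1 : Commute c2 x1 := (p2y.mul_right p2x).mul_right p2y.inv_right
  have p1x2 : Commute c1 x2 := (p1y.mul_right p1x1).mul_right p1y.inv_right
  have p2x2 : Commute c2 x2 := (p2y.mul_right p2x1).mul_right p2y.inv_right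
  have p12 : Commute c1 c2 := (p1x.mul_right p1x2).mul_right p1x1
  have hconj : x1 * x2 * x1⁻¹ = (c1 * c2) * x2 := by
    have h3 : c2⁻¹ = c2 := inv_eq_of_mul_eq_one_right p2
    have : c1 * c2⁻¹ = x * (x1 * x2 * x1⁻¹ * x2⁻¹) * x⁻¹ := by rw [hc1, hc2]; group
    have hx' : x⁻¹ * (c1 * c2⁻¹) * x = c1 * c2⁻¹ := by
      have : Commute (c1 * c2⁻¹) x := p1x.mul_left p2x.inv_left
      rw [mul_assoc, this.eq]; group
    rw [← h3, ← hx', this]; group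
  have he : c1 * c2 = 1 := by
    refine cube _ ?_ ?_
    · calc c1 * c2 * (c1 * c2) = c1 * (c2 * c1) * c2 := by simp only [mul_assoc]
        _ = (c1 * c1) * (c2 * c2) := by rw [← p12.eq]; simp only [mul_assoc]
        _ = 1 := by rw [p1, p2, one_mul]
    · have h3 : (x1 * x2 * x1⁻¹) ^ 3 = (c1 * c2 * x2) ^ 3 := by rw [hconj]
      rw [conj_pow, hx23, (p1x2.mul_left p2x2).mul_pow, hx23] at h3
      simpa using h3.symm
  rw [he, one_mul] at hconj
  have h12 : Commute x1 x2 := mul_inv_eq_iff_eq_mul.mp hconj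
  have h20 : Commute x2 x := by
    have := h12.map (MulAut.conj y)
    simp only [MulAut.conj_apply] at this
    rwa [conj3, ← hx2] at this
  have h01 : Commute x x1 := by
    have := h20.map (MulAut.conj y)
    simp only [MulAut.conj_apply] at this
    rwa [conj3, ← hx1] at this
  have hc11 : c1 = 1 := by
    refine cube _ p1 ?_
    have h3 : Commute (x * x1) x2 := h20.symm.mul_left h12
    rw [hc1, h3.mul_pow, h01.mul_pow, hx, hx13, hx23]
    simp
  exact ⟨h01, hc11, e1.trans hc11⟩

/-- Two elements of order three that generate a group of exponent three have a central commutator of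
order dividing three. -/
theorem exists_central_commutator {r t : G} (hr : r ^ 3 = 1) (ht : t ^ 3 = 1)
    (h1 : (r * t) ^ 3 = 1) (h2 : (r * t⁻¹) ^ 3 = 1) :
    ∃ k : G, k ^ 3 = 1 ∧ Commute k r ∧ Commute k t ∧ t * r = r * t * k := by
  obtain ⟨hc, hp, -⟩ := commute_conj_of_cubes (z := 1) (one_mul 1) (Commute.one_left _)
    (Commute.one_left _) hr ht (Or.inl h1) (Or.inl h2)
  set r1 := t * r * t⁻¹ with hr1
  have hr13 : r1 ^ 3 = 1 := by rw [hr1, conj_pow, hr]; group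
  have hkt : t * (r⁻¹ * r1) * t⁻¹ = r⁻¹ * r1 := by
    have h3 : t * r1 * t⁻¹ = (r * r1)⁻¹ := by
      rw [eq_comm, inv_eq_iff_mul_eq_one]; exact hp
    have h4 : r1⁻¹ * r1⁻¹ = r1 := by
      rw [← mul_inv_rev, inv_eq_iff_mul_eq_one, ← pow_two, ← pow_succ, hr13]
    calc t * (r⁻¹ * r1) * t⁻¹ = (t * r * t⁻¹)⁻¹ * (t * r1 * t⁻¹) := by group
      _ = r1⁻¹ * (r1⁻¹ * r⁻¹) := by rw [← hr1, h3, mul_inv_rev r r1]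
      _ = r⁻¹ * r1 := by rw [← mul_assoc, h4, hc.symm.inv_right.eq]
  have hkr : Commute (r⁻¹ * r1) r := ((Commute.refl r).inv_left).mul_left hc.symm
  have hkt' : Commute (r⁻¹ * r1) t := (mul_inv_eq_iff_eq_mul.mp hkt).symm
  refine ⟨r⁻¹ * r1, ?_, hkr, hkt', ?_⟩
  · rw [(hc.inv_left).mul_pow, hr13, inv_pow, hr]; simp
  · rw [mul_assoc, ← hkt'.eq, hr1]; group

/-- Three involutions `a`, `b`, `c` whose products `r = a b` and `t = a c` generate a group of
exponent three: `t` lies in `⟨r⟩`. Otherwise `⟨r, t⟩` maps onto `ℤ₃²`, on which `a` acts by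
inversion, and the spectrum of `a + b + c` contains `√3`: it belongs to a character that is trivial
on `r` and nontrivial on `t`. -/
theorem InCayleyClass.mem_zpowers_of_three_involutions [Fintype G] (hG : InCayleyClass 4 G)
    {a b c : G} (ha : a * a = 1) (hb : b * b = 1) (hc : c * c = 1) (ha1 : a ≠ 1) (hb1 : b ≠ 1)
    (hc1 : c ≠ 1) (hab : a ≠ b) (hr : (a * b) ^ 3 = 1) (ht : (a * c) ^ 3 = 1)
    (h1 : ((a * b) * (a * c)) ^ 3 = 1) (h2 : ((a * b) * (a * c)⁻¹) ^ 3 = 1) :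
    ∃ i : ℤ, a * c = (a * b) ^ i := by
  by_contra! hcon
  obtain ⟨k, hk, hkr, hkt, htr⟩ := exists_central_commutator hr ht h1 h2
  have hac : a ≠ c := by
    rintro rfl
    exact hcon 0 (by simpa using ha)
  have hbc : b ≠ c := by
    rintro rfl
    exact hcon 1 (by simp)
  have hs := hG.integralSpectrum [a, b, c] (by simp [hab, hac, hbc]) (by simp)
    (by simp [inv_eq_of_mul_eq_one_right ha, inv_eq_of_mul_eq_one_right hb,
      inv_eq_of_mul_eq_one_right hc]) (by simp [eq_comm, ha1, hb1, hc1])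
  have hri : (a * b)⁻¹ = b * a := by
    rw [mul_inv_rev, inv_eq_of_mul_eq_one_right ha, inv_eq_of_mul_eq_one_right hb]
  have hti : (a * c)⁻¹ = c * a := by
    rw [mul_inv_rev, inv_eq_of_mul_eq_one_right ha, inv_eq_of_mul_eq_one_right hc]
  have hri' : (a * b)⁻¹ = (a * b) * (a * b) := by
    rw [inv_eq_iff_mul_eq_one, ← pow_two, ← pow_succ', hr]
  have hti' : (a * c)⁻¹ = (a * c) * (a * c) := by
    rw [inv_eq_iff_mul_eq_one, ← pow_two, ← pow_succ', ht]
  have hbc' : b * c = (a * b)⁻¹ * (a * c) := by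
    rw [hri, mul_assoc, ← mul_assoc a a, ha, one_mul]
  have hcb' : c * b = (a * c)⁻¹ * (a * b) := by
    rw [hti, mul_assoc, ← mul_assoc a a, ha, one_mul]
  set r := a * b with hrdef
  set t := a * c with htdef
  let δ := MonoidAlgebra.of ℂ G
  have dAA : δ a * δ a = 1 := by rw [← map_mul, ha, map_one]
  have dBB : δ b * δ b = 1 := by rw [← map_mul, hb, map_one]
  have dCC : δ c * δ c = 1 := by rw [← map_mul, hc, map_one]
  have dAB : δ a * δ b = δ r := by rw [← map_mul]
  have dAC : δ a * δ c = δ t := by rw [← map_mul]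
  have dBA : δ b * δ a = δ r * δ r := by rw [← map_mul, ← map_mul, ← hri, hri']
  have dCA : δ c * δ a = δ t * δ t := by rw [← map_mul, ← map_mul, ← hti, hti']
  have dBC : δ b * δ c = δ r * δ r * δ t := by
    rw [← map_mul, ← map_mul, ← map_mul, hbc', hri']
  have dCB : δ c * δ b = δ t * δ t * δ r := by
    rw [← map_mul, ← map_mul, ← map_mul, hcb', hti']
  have dR : δ r * (δ r * δ r) = 1 := by
    rw [← map_mul, ← map_mul, ← hri', mul_inv_cancel, map_one]
  have dT : δ t * (δ t * δ t) = 1 := by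
    rw [← map_mul, ← map_mul, ← hti', mul_inv_cancel, map_one]
  have dK : δ k * (δ k * δ k) = 1 := by
    rw [← map_mul, ← map_mul, ← pow_two, ← pow_succ', hk, map_one]
  have dKR : δ k * δ r = δ r * δ k := by rw [← map_mul, ← map_mul, hkr.eq]
  have dKT : δ k * δ t = δ t * δ k := by rw [← map_mul, ← map_mul, hkt.eq]
  have dTR : δ t * δ r = δ r * δ t * δ k := by rw [← map_mul, ← map_mul, ← map_mul, htr]
  -- On the elements fixed by `k`, the actions of `r` and `t` commute.
  have fR : ∀ y, δ k * y = y → δ k * (δ r * y) = δ r * y := by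
    intro y hy; rw [← mul_assoc, dKR, mul_assoc, hy]
  have fTR : ∀ y, δ k * y = y → δ t * (δ r * y) = δ r * (δ t * y) := by
    intro y hy; rw [← mul_assoc, dTR, mul_assoc, mul_assoc, hy]
  set N := 1 + δ k + δ k * δ k with hNdef
  have hN : δ k * N = N := by
    rw [hNdef, mul_add, mul_add, dK, mul_one]; abel
  have fT : ∀ y, δ k * y = y → δ k * (δ t * y) = δ t * y := by
    intro y hy; rw [← mul_assoc, dKT, mul_assoc, hy]
  set M := N - δ t * N with hMdef
  have hM : δ k * M = M := by rw [hMdef, mul_sub, hN, fT _ hN]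
  have hTM : δ t * M + δ t * (δ t * M) = -M := by
    have : δ t * (δ t * (δ t * N)) = N := by
      rw [← mul_assoc (δ t) (δ t) N, ← mul_assoc, dT, one_mul]
    rw [hMdef, mul_sub, mul_sub, this]; abel
  set v := M + δ r * M + δ r * (δ r * M) with hvdef
  have hrrr : ∀ y, δ r * (δ r * (δ r * y)) = y := by
    intro y; rw [← mul_assoc (δ r) (δ r) y, ← mul_assoc, dR, one_mul]
  have hRv : δ r * v = v := by
    rw [hvdef, mul_add, mul_add, hrrr]; abel
  have expT : ∀ y, δ k * y = y → δ t * (y + δ r * y + δ r * (δ r * y))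
      = δ t * y + δ r * (δ t * y) + δ r * (δ r * (δ t * y)) := by
    intro y hy
    rw [mul_add, mul_add, fTR _ hy, fTR _ (fR _ hy), fTR _ hy]
  have hRTv : δ r * (δ t * v) = δ t * v := by
    rw [hvdef, expT M hM, mul_add, mul_add, hrrr]; abel
  have hTv : δ t * v + δ t * (δ t * v) = -v := by
    rw [hvdef, expT M hM, expT _ (fT _ hM)]
    calc _ = (δ t * M + δ t * (δ t * M)) + δ r * (δ t * M + δ t * (δ t * M))
          + δ r * (δ r * (δ t * M + δ t * (δ t * M))) := by noncomm_ring
      _ = _ := by rw [hTM]; noncomm_ring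
  have hv0 : v = 0 := by
    refine hs.eq_zero 0 3 ?_ ?_
    · intro n hn
      have h3 : n ≤ 2 := by nlinarith
      have h3' : -2 ≤ n := by nlinarith
      interval_cases n <;> omega
    · have hs1 : ([a, b, c].map (MonoidAlgebra.of ℂ G)).sum = δ a + δ b + δ c := by
        simp only [List.map_cons, List.map_nil, List.sum_cons, List.sum_nil, δ]
        abel
      rw [hs1]
      calc (δ a + δ b + δ c) * ((δ a + δ b + δ c) * v)
          = δ a * δ a * v + δ b * δ b * v + δ c * δ c * v + δ a * δ b * v + δ b * δ a * v
            + δ a * δ c * v + δ c * δ a * v + δ b * δ c * v + δ c * δ b * v := by noncomm_ring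
        _ = 5 * v + 2 * (δ t * v + δ t * (δ t * v)) := by
          rw [dAA, dBB, dCC, dAB, dBA, dAC, dCA, dBC, dCB]
          simp only [mul_assoc, hRv, hRTv]
          noncomm_ring
        _ = _ := by
          rw [hTv]
          simp only [Int.cast_zero, zero_smul, Int.cast_ofNat, ofNat_smul_eq_nsmul]
          noncomm_ring
  have key : ∀ i j : ℕ, (1 : G) ≠ r ^ i * t * k ^ j := by
    intro i j h
    have h3 : t = (r ^ i)⁻¹ * (k ^ j)⁻¹ := by
      rw [mul_assoc] at h
      rw [eq_inv_mul_iff_mul_eq, eq_inv_iff_mul_eq_one, mul_assoc, ← h]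
    have h4 : Commute t r := by
      rw [h3]
      exact ((Commute.refl r).pow_left i).inv_left.mul_left (hkr.pow_left j).inv_left
    have h5 : k = 1 := by
      rw [h4.eq] at htr
      simpa using htr.symm
    refine hcon (-i) ?_
    rw [h3, h5]
    simp
  refine sum_sub_sum_ne_zero
    [1, k, k ^ 2, r, r * k, r * k ^ 2, r ^ 2, r ^ 2 * k, r ^ 2 * k ^ 2]
    [r ^ 0 * t * k ^ 0, r ^ 0 * t * k ^ 1, r ^ 0 * t * k ^ 2,
      r ^ 1 * t * k ^ 0, r ^ 1 * t * k ^ 1, r ^ 1 * t * k ^ 2,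
      r ^ 2 * t * k ^ 0, r ^ 2 * t * k ^ 1, r ^ 2 * t * k ^ 2] (by simp) ?_ ?_
  · simp only [List.mem_cons, List.not_mem_nil, or_false, not_or]
    exact ⟨key _ _, key _ _, key _ _, key _ _, key _ _, key _ _, key _ _, key _ _, key _ _⟩
  · rw [← hv0, hvdef, hMdef, hNdef]
    simp only [List.map_cons, List.map_nil, List.sum_cons, List.sum_nil, map_mul, map_one, map_pow,
      δ]
    noncomm_ring

end Configurations

/-! ### Noncommuting involutions: the symmetric group -/

section NoncommutingInvolutions

variable {G : Type*} [Group G] [Fintype G]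

theorem InCayleyClass.commute_or_cube (hG : InCayleyClass 4 G) {a b : G}
    (ha : a * a = 1) (hb : b * b = 1) : a * b = b * a ∨ (a * b) ^ 3 = 1 := by
  rcases hG.sq_or_cube_mul ha hb (one_mul 1) with (h | h) | (h | h)
  iterate 2
    left
    rw [pow_two, ← eq_inv_iff_mul_eq_one, mul_inv_rev, inv_eq_of_mul_eq_one_right ha,
      inv_eq_of_mul_eq_one_right hb] at h
    exact h
  all_goals exact Or.inr h

theorem braid_of_cube_eq_one {G : Type*} [Group G] {a b : G} (ha : a * a = 1) (hb : b * b = 1)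
    (h : (a * b) ^ 3 = 1) : b * a * b = a * b * a := by
  have h1 : (a * b * a) * (b * a * b) = 1 := by
    rw [← h]; simp only [pow_succ, pow_zero, one_mul, mul_assoc]
  have h2 : (a * b * a) * (a * b * a) = 1 := by
    calc (a * b * a) * (a * b * a) = a * (b * (a * a) * b) * a := by simp only [mul_assoc]
      _ = 1 := by rw [ha, mul_one, hb, mul_one, ha]
  exact mul_left_cancel (h1.trans h2.symm)

/-- An involution that commutes with `a` but not with all of `⟨a, b⟩ ≅ S₃` would generate with
`⟨a, b⟩` the group `S₃ × ℤ₂` or the group `S₄`, in which some product of two involutions has order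
six or four. -/
theorem InCayleyClass.eq_of_commute_involution (hG : InCayleyClass 4 G) {a b c : G}
    (ha : a * a = 1) (hb : b * b = 1) (hc : c * c = 1) (hab : a * b ≠ b * a)
    (hac : a * c = c * a) : c = 1 ∨ c = a := by
  have hab3 := (hG.commute_or_cube ha hb).resolve_left hab
  have bab := braid_of_cube_eq_one ha hb hab3
  rcases hG.commute_or_cube hb hc with hbc | hbc3
  · have hbc2 : (b * c) * (b * c) = 1 := by
      calc (b * c) * (b * c) = b * (c * b) * c := by simp only [mul_assoc]
        _ = (b * b) * (c * c) := by rw [← hbc]; simp only [mul_assoc]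
        _ = 1 := by rw [hb, hc, one_mul]
    rcases hG.commute_or_cube ha hbc2 with h | h
    · refine absurd ?_ hab
      have : a * b * c = b * a * c := by rw [mul_assoc, h, mul_assoc, ← hac, mul_assoc]
      exact mul_right_cancel this
    · left
      have hcomm : Commute (a * b) c := (show Commute a c from hac).mul_left hbc
      rw [← mul_assoc, hcomm.mul_pow, hab3, one_mul, pow_succ, pow_two, hc, one_mul] at h
      exact h
  · right
    have bcb : b * c * b = c * b * c := (braid_of_cube_eq_one hb hc hbc3).symm
    have hac2 : (a * c) * (a * c) = 1 := by
      rw [hac]; nth_rw 2 [← hac]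
      rw [mul_assoc, ← mul_assoc a, ha, one_mul, hc]
    have aca : a * c * a = c := by rw [hac, mul_assoc, ha, mul_one]
    have cac : c * a * c = a := by rw [← hac, mul_assoc, hc, mul_one]
    have key : b * (a * c) * b = a * (b * (a * c) * b) * c := by
      calc b * (a * c) * b = (b * a * b) * (b * c * b) := by
            calc b * (a * c) * b = b * a * (b * b) * c * b := by rw [hb]; group
              _ = _ := by simp only [mul_assoc]
        _ = _ := by rw [bab, bcb]; simp only [mul_assoc]
    rcases hG.commute_or_cube hb hac2 with h | h
    · rw [h, mul_assoc, hb, mul_one] at key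
      have : a * c = 1 := by
        rw [key, ← mul_assoc, ha, one_mul, hc]
      rw [← mul_right_inj a, ha, this]
    · refine absurd ?_ hab
      have h1 : a * c * b = 1 := by
        rw [← h]
        symm
        calc (b * (a * c)) ^ 3 = (b * (a * c) * b) * (a * c) * (b * (a * c)) := by
              simp only [pow_succ, pow_zero, one_mul, mul_assoc]
          _ = a * b * a * c * b * (c * a * c) * b * a * c := by
              rw [key]; simp only [mul_assoc]
          _ = a * b * a * c * (b * a * b) * a * c := by rw [cac]; simp only [mul_assoc]
          _ = a * b * (a * c * a) * b * (a * a) * c := by rw [bab]; simp only [mul_assoc]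
          _ = a * (b * c * b) * c := by rw [aca, ha, mul_one]; simp only [mul_assoc]
          _ = a * c * b * (c * c) := by rw [bcb]; simp only [mul_assoc]
          _ = a * c * b := by rw [hc, mul_one]
      have h2 : b = a * c := by
        rw [← inv_eq_of_mul_eq_one_right h1, inv_eq_of_mul_eq_one_right hac2]
      rw [h2, aca, ← mul_assoc, ha, one_mul]

/-- If the involutions `a`, `b` do not commute, then every involution lies in `⟨a, b⟩ ≅ S₃`. -/
theorem InCayleyClass.involution_mem (hG : InCayleyClass 4 G) {a b c : G}
    (ha : a * a = 1) (hb : b * b = 1) (hc : c * c = 1) (hab : a * b ≠ b * a) :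
    c = 1 ∨ c = a ∨ c = b ∨ c = a * b * a := by
  have hab3 := (hG.commute_or_cube ha hb).resolve_left hab
  have ha1 : a ≠ 1 := by rintro rfl; simp at hab
  have hb1 : b ≠ 1 := by rintro rfl; simp at hab
  by_contra! h
  obtain ⟨hc1, hca, hcb, hcd⟩ := h
  have hac3 : (a * c) ^ 3 = 1 := by
    refine (hG.commute_or_cube ha hc).resolve_left fun h => ?_
    rcases hG.eq_of_commute_involution ha hb hc hab h with h | h
    · exact hc1 h
    · exact hca h
  have hbc3 : (b * c) ^ 3 = 1 := by
    refine (hG.commute_or_cube hb hc).resolve_left fun h => ?_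
    rcases hG.eq_of_commute_involution hb ha hc (Ne.symm hab) h with h | h
    · exact hc1 h
    · exact hcb h
  have hd : (a * b * a) * (a * b * a) = 1 := by
    calc (a * b * a) * (a * b * a) = a * (b * (a * a) * b) * a := by simp only [mul_assoc]
      _ = 1 := by rw [ha, mul_one, hb, mul_one, ha]
  have hdc3 : (a * b * a * c) ^ 3 = 1 := by
    refine (hG.commute_or_cube hd hc).resolve_left fun h => ?_
    have hda : a * b * a * a ≠ a * (a * b * a) := by
      intro h
      rw [mul_assoc, ha, mul_one, ← mul_assoc, ← mul_assoc, ha, one_mul] at h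
      exact hab h
    rcases hG.eq_of_commute_involution hd ha hc hda h with h | h
    · exact hc1 h
    · exact hcd h
  have h2 : (a * b * (a * c)⁻¹) ^ 3 = 1 := by
    rw [mul_inv_rev, inv_eq_of_mul_eq_one_right hc]
    have : a * b * (c * a⁻¹) = a * (b * c) * a⁻¹ := by group
    rw [this, conj_pow, hbc3]; group
  obtain ⟨i, hi⟩ := hG.mem_zpowers_of_three_involutions ha hb hc ha1 hb1 hc1
    (by rintro rfl; exact hab rfl) hab3 hac3 (by rw [← mul_assoc]; exact hdc3) h2
  have hmod : (a * b) ^ i = (a * b) ^ (i % 3) := by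
    conv_lhs => rw [← Int.emod_add_mul_ediv i 3, zpow_add, zpow_mul]
    have : (a * b) ^ (3 : ℤ) = 1 := by exact_mod_cast hab3
    rw [this]; simp
  have h0 : 0 ≤ i % 3 := Int.emod_nonneg _ (by norm_num)
  have h3 : i % 3 < 3 := Int.emod_lt_of_pos _ (by norm_num)
  rw [hmod] at hi
  have hc' : c = a * (a * b) ^ (i % 3) := by rw [← hi, ← mul_assoc, ha, one_mul]
  generalize i % 3 = j at h0 h3 hc'
  interval_cases j
  · exact hca (by simpa using hc')
  · exact hcb (by rw [hc', zpow_one, ← mul_assoc, ha, one_mul])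
  · refine hcd ?_
    rw [hc', ← braid_of_cube_eq_one ha hb hab3]
    calc a * (a * b) ^ (2 : ℤ) = (a * a) * b * a * b := by
          rw [zpow_ofNat, pow_two]; simp only [mul_assoc]
      _ = _ := by rw [ha, one_mul]

/-- The centralizer of `⟨a, b⟩ ≅ S₃` contains no involution, and no element of order three because
`S₃ × ℤ₃` is not in the class. -/
theorem InCayleyClass.eq_one_of_commute_noncommuting (hG : InCayleyClass 4 G) {a b g : G}
    (ha : a * a = 1) (hb : b * b = 1) (hab : a * b ≠ b * a) (hga : a * g = g * a)
    (hgb : b * g = g * b) : g = 1 := by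
  have inv : ∀ h : G, h * h = 1 → a * h = h * a → b * h = h * b → h = 1 := by
    intro h h2 h3 h4
    rcases hG.eq_of_commute_involution ha hb h2 hab h3 with h | rfl
    · exact h
    · exact absurd h4.symm hab
  have cg : Commute a g := hga
  have cg' : Commute b g := hgb
  rcases hG.pow_four_or_pow_six (by norm_num) g with h | h
  · have h2 : g ^ 2 = 1 := inv _ (by rw [← pow_add]; exact h) (cg.pow_right 2) (cg'.pow_right 2)
    exact inv _ (by rw [← pow_two]; exact h2) cg cg'
  · have h3 : g ^ 3 = 1 := inv _ (by rw [← pow_add]; exact h) (cg.pow_right 3) (cg'.pow_right 3)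
    exact hG.eq_one_of_symm_prod_cyclic ha hb (by rintro rfl; simp at hab)
      ((hG.commute_or_cube ha hb).resolve_left hab) (by rintro rfl; exact hab rfl) cg.symm cg'.symm
      h3

/-- If two involutions do not commute, then conjugation of the involutions identifies the group
with `S₃`. -/
theorem InCayleyClass.nonempty_mulEquiv_perm (hG : InCayleyClass 4 G) {a b : G}
    (ha : a * a = 1) (hb : b * b = 1) (hab : a * b ≠ b * a) :
    Nonempty (G ≃* Equiv.Perm (Fin 3)) := by
  classical
  let X := {g : G // g * g = 1 ∧ g ≠ 1}
  have ha1 : a ≠ 1 := by rintro rfl; simp at hab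
  have hb1 : b ≠ 1 := by rintro rfl; simp at hab
  let φ : G →* Equiv.Perm X :=
    { toFun := fun g => (MulAut.conj g).toEquiv.subtypeEquiv (fun x => by
        change _ ↔ MulAut.conj g x * MulAut.conj g x = 1 ∧ MulAut.conj g x ≠ 1
        rw [← map_mul]
        simp only [ne_eq, EmbeddingLike.map_eq_one_iff])
      map_one' := by ext x; simp
      map_mul' := by intro g h; ext x; simp }
  have hφ : Function.Injective φ := by
    rw [injective_iff_map_eq_one]
    intro g hg
    have h1 : ∀ x : X, g * x.1 * g⁻¹ = x.1 := fun x =>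
      congrArg Subtype.val (DFunLike.congr_fun hg x)
    refine hG.eq_one_of_commute_noncommuting ha hb hab ?_ ?_
    · exact (mul_inv_eq_iff_eq_mul.mp (h1 ⟨a, ha, ha1⟩)).symm
    · exact (mul_inv_eq_iff_eq_mul.mp (h1 ⟨b, hb, hb1⟩)).symm
  have hd : (a * b * a) * (a * b * a) = 1 := by
    calc (a * b * a) * (a * b * a) = a * (b * (a * a) * b) * a := by simp only [mul_assoc]
      _ = 1 := by rw [ha, mul_one, hb, mul_one, ha]
  have hd1 : a * b * a ≠ 1 := by
    intro h
    have := (conj_eq_one_iff (a := a) (b := b)).mp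
      (by rw [inv_eq_of_mul_eq_one_right ha]; exact h)
    exact hb1 this
  have hcard : Fintype.card X = 3 := by
    have hset : (Finset.univ.filter fun g : G => g * g = 1 ∧ g ≠ 1) = {a, b, a * b * a} := by
      ext g
      simp only [Finset.mem_filter, Finset.mem_univ, true_and, Finset.mem_insert,
        Finset.mem_singleton]
      constructor
      · rintro ⟨h, h1⟩
        exact (hG.involution_mem ha hb h hab).resolve_left h1
      · rintro (rfl | rfl | rfl)
        exacts [⟨ha, ha1⟩, ⟨hb, hb1⟩, ⟨hd, hd1⟩]
    rw [Fintype.card_subtype, hset, Finset.card_eq_three]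
    refine ⟨a, b, a * b * a, by rintro rfl; exact hab rfl, ?_, ?_, rfl⟩
    · intro h
      rw [mul_assoc] at h
      have h1 : b * a = 1 := by simpa using h.symm
      exact hab (by rw [h1]; rw [mul_eq_one_iff_eq_inv] at h1; rw [h1]; simp)
    · intro h
      apply hab
      nth_rw 2 [h]
      rw [mul_assoc (a * b), ha, mul_one]
  let e : Equiv.Perm X ≃* Equiv.Perm (Fin 3) := (Fintype.equivFinOfCardEq hcard).permCongrHom
  let ψ : G →* Equiv.Perm (Fin 3) := e.toMonoidHom.comp φ
  have hψ : Function.Injective ψ := e.injective.comp hφ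
  have hdvd : Nat.card G ∣ 6 := by
    have := Subgroup.card_dvd_of_injective ψ hψ
    simpa [Nat.card_eq_fintype_card, Fintype.card_perm, Nat.factorial] using this
  have hnp : ∀ p : ℕ, p.Prime → Nat.card G ≠ p := by
    intro p hp h
    have := Fact.mk hp
    have := isCyclic_of_prime_card h
    exact hab (IsCyclic.commGroup.mul_comm a b)
  have h6 : Nat.card G = 6 := by
    have hle := Nat.le_of_dvd (by norm_num) hdvd
    have hn1 : Nat.card G ≠ 1 := by
      intro h
      have := (Nat.card_eq_one_iff_unique.mp h).1
      exact ha1 (Subsingleton.elim _ _)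
    have hpos : 0 < Nat.card G := Nat.card_pos
    have hn2 := hnp 2 Nat.prime_two
    have hn3 := hnp 3 Nat.prime_three
    generalize Nat.card G = n at *
    interval_cases n <;> omega
  have hbij : Function.Bijective ψ := by
    rw [Fintype.bijective_iff_injective_and_card]
    refine ⟨hψ, ?_⟩
    rw [← Nat.card_eq_fintype_card, h6]
    simp [Fintype.card_perm, Nat.factorial]
  exact ⟨MulEquiv.ofBijective ψ hbij⟩

end NoncommutingInvolutions

/-! ### Commuting involutions -/

section CommutingInvolutions

variable {G : Type*} [Group G] [Fintype G]

/-- Otherwise the products of the conjugates of `a` under `⟨x⟩` would generate with `x` a group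
`A₄`. -/
theorem InCayleyClass.commute_involution_cube (hG : InCayleyClass 4 G)
    (hI : ∀ a b : G, a * a = 1 → b * b = 1 → a * b = b * a) {a x : G} (ha : a * a = 1)
    (hx : x ^ 3 = 1) : a * x = x * a := by
  have conj_sq : ∀ g : G, g * g = 1 → (x * g * x⁻¹) * (x * g * x⁻¹) = 1 := by
    intro g hg
    calc (x * g * x⁻¹) * (x * g * x⁻¹) = x * (g * g) * x⁻¹ := by group
      _ = 1 := by rw [hg]; group
  set a1 := x * a * x⁻¹ with ha1
  set a2 := x * a1 * x⁻¹ with ha2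
  have h1 : a1 * a1 = 1 := conj_sq a ha
  have h2 : a2 * a2 = 1 := conj_sq a1 h1
  have h3 : x * a2 * x⁻¹ = a := by
    calc x * a2 * x⁻¹ = x ^ 3 * a * (x ^ 3)⁻¹ := by
          rw [ha2, ha1]; simp only [pow_succ, pow_zero, one_mul, mul_inv_rev, mul_assoc]
      _ = a := by rw [hx]; group
  have p01 := hI a a1 ha h1
  have p02 := hI a a2 ha h2
  have prod : (a * a1) * (a1 * a2) = a * a2 := by
    rw [mul_assoc, ← mul_assoc a1, h1, one_mul]
  have hα : (a * a1) * (a * a1) = 1 := by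
    nth_rw 2 [p01]
    rw [mul_assoc, ← mul_assoc a1, h1, one_mul, ha]
  have hβ : x * (a * a1) * x⁻¹ = a1 * a2 := by rw [ha2, ha1]; group
  have hγ : x * (a1 * a2) * x⁻¹ = a2 * a := by
    calc x * (a1 * a2) * x⁻¹ = (x * a1 * x⁻¹) * (x * a2 * x⁻¹) := by group
      _ = a2 * a := by rw [h3, ← ha2]
  have hββ : (a1 * a2) * (a1 * a2) = 1 := by rw [← hβ]; exact conj_sq _ hα
  have := hG.eq_one_of_alternating hα hβ (by rw [hγ, prod, p02]) (hI _ _ hββ hα) hx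
  have h4 : a1 = a := by
    rw [← mul_right_inj a, this, ha]
  exact (mul_inv_eq_iff_eq_mul.mp h4).symm

theorem InCayleyClass.eq_one_of_commute_order_four (hG : InCayleyClass 4 G) {u x z : G}
    (hu : u * u = z) (hz : z * z = 1) (hz1 : z ≠ 1) (hx : x ^ 3 = 1) (hux : u * x = x * u) :
    x = 1 := by
  have h : Commute u x := hux
  have hu4 : u ^ 4 = 1 := by
    rw [show 4 = 2 * 2 from rfl, pow_mul, pow_two u, hu, pow_two, hz]
  have hx4 : x ^ 4 = x := by rw [pow_succ, hx, one_mul]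
  have hx6 : x ^ 6 = 1 := by rw [show 6 = 3 * 2 from rfl, pow_mul, hx, one_pow]
  have hu6 : u ^ 6 = z := by rw [show 6 = 4 + 2 from rfl, pow_add, hu4, one_mul, pow_two, hu]
  rcases hG.pow_four_or_pow_six (by norm_num) (u * x) with h4 | h6
  · rwa [h.mul_pow, hu4, one_mul, hx4] at h4
  · rw [h.mul_pow, hu6, hx6, mul_one] at h6
    exact absurd h6 hz1

/-- Elements of order four invert the elements of order three. The conjugates of `u` under `⟨x⟩`
have the same square `z`, so they are involutions modulo `⟨z⟩`. If they commute there, they generate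
with `x` a group `SL(2, 3)`. If their products have order three there, then `x` and `u x u⁻¹`
generate a group of exponent three modulo `⟨z⟩`, where the order of `(u x)²` shows that
`u x u⁻¹ = x⁻¹`. -/
theorem InCayleyClass.conj_eq_inv (hG : InCayleyClass 4 G)
    (hI : ∀ a b : G, a * a = 1 → b * b = 1 → a * b = b * a) {u x z : G} (hu : u * u = z)
    (hz : z * z = 1) (hz1 : z ≠ 1) (hx : x ^ 3 = 1) : u * x * u⁻¹ = x⁻¹ := by
  by_cases hx1 : x = 1
  · rw [hx1]; group
  have hux : u * x ≠ x * u := fun h => hx1 (hG.eq_one_of_commute_order_four hu hz hz1 hx h)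
  have hzx : Commute z x := hG.commute_involution_cube hI hz hx
  have hzu : Commute z u := by
    change z * u = u * z
    rw [← hu, mul_assoc]
  have hui : u⁻¹ = z * u := by
    rw [inv_eq_iff_mul_eq_one, ← mul_assoc, ← hzu.eq, mul_assoc, hu, hz]
  have conj_sq : ∀ g : G, g * g = z → (x * g * x⁻¹) * (x * g * x⁻¹) = z := by
    intro g hg
    calc (x * g * x⁻¹) * (x * g * x⁻¹) = x * (g * g) * x⁻¹ := by group
      _ = z := by rw [hg, ← hzx.eq]; group
  set u1 := x * u * x⁻¹ with hu1
  have h1 : u1 * u1 = z := conj_sq u hu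
  rcases hG.sq_or_cube_mul hu h1 hz with h | h
  · exfalso
    set u2 := x * u1 * x⁻¹ with hu2
    have h2 : u2 * u2 = z := conj_sq u1 h1
    have h3 : x * u2 * x⁻¹ = u := by
      calc x * u2 * x⁻¹ = x ^ 3 * u * (x ^ 3)⁻¹ := by
            rw [hu2, hu1]; simp only [pow_succ, pow_zero, one_mul, mul_inv_rev, mul_assoc]
        _ = u := by rw [hx]; group
    have hne : u1 ≠ u := fun h => hux (mul_inv_eq_iff_eq_mul.mp h).symm
    have hrz : u * u1 ≠ z := by
      intro h
      exact hne (by rw [← mul_right_inj u, h, hu])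
    have hβ : x * (u * u1) * x⁻¹ = u1 * u2 := by rw [hu2, hu1]; group
    have hγ : x * (u1 * u2) * x⁻¹ = u2 * u := by
      calc x * (u1 * u2) * x⁻¹ = (x * u1 * x⁻¹) * (x * u2 * x⁻¹) := by group
        _ = u2 * u := by rw [h3, ← hu2]
    have prod : (u * u1) * (u1 * u2) = z * (u * u2) := by
      rw [mul_assoc, ← mul_assoc u1, h1, ← mul_assoc, ← hzu.eq, mul_assoc]
    rcases h with h | h
    · rw [pow_two] at h
      have h4 := hG.commute_involution_cube hI h hx
      have h5 : x * (u * u1) * x⁻¹ = u * u1 := by rw [← h4]; group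
      have h6 : u2 * u = u * u1 := by rw [← hγ, ← hβ, h5, h5]
      have h7 : z * (u * u2) = 1 := by rw [← prod, ← hβ, h5, h]
      have h8 : u * u2 = z := by
        rw [← inv_eq_of_mul_eq_one_right h7, inv_eq_of_mul_eq_one_right hz]
      have h9 : u2 = u := by rw [← mul_right_inj u, h8, hu]
      rw [h9, hu] at h6
      exact hrz h6.symm
    · rw [pow_two] at h
      have hzx' : x * z = z * x := hzx.eq.symm
      have hzu2 : Commute z u2 := by
        change z * u2 = u2 * z
        rw [← h2, mul_assoc]
      have hinv2 : u2⁻¹ = z * u2 := by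
        rw [inv_eq_iff_mul_eq_one, ← mul_assoc, ← hzu2.eq, mul_assoc, h2, hz]
      have h4 : (u2 * u) * (u2 * u) = z := by
        rw [← hγ, ← hβ]
        exact conj_sq _ (conj_sq _ h)
      have h5 : u2 * u = z * (u * u2) := by
        have : u2 * u = z * (u⁻¹ * u2⁻¹) := by
          rw [← mul_inv_rev, ← h4, mul_inv_cancel_right]
        rw [this, hui, hinv2]
        congr 1
        calc z * u * (z * u2) = z * (u * z) * u2 := by simp only [mul_assoc]
          _ = z * z * (u * u2) := by rw [← hzu.eq]; simp only [mul_assoc]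
          _ = u * u2 := by rw [hz, one_mul]
      refine hz1 (hG.eq_one_of_binaryTetrahedral (α := u * u1) (β := u1 * u2) h hz hzx' hβ
        (Or.inl (by rw [hγ, prod, h5])) (Or.inr ?_) hx)
      have hββ : (u1 * u2) * (u1 * u2) = z := by rw [← hβ]; exact conj_sq _ h
      have hγγ : ((u * u1) * (u1 * u2)) * ((u * u1) * (u1 * u2)) = z := by
        rw [prod, ← h5, h4]
      generalize u * u1 = α at *
      generalize u1 * u2 = β at *
      have i1 : α⁻¹ = z * α := by
        rw [inv_eq_iff_mul_eq_one, ← h, ← mul_assoc, ← mul_assoc, h, mul_assoc, h, hz]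
      have i2 : β⁻¹ = β * z := by
        rw [inv_eq_iff_mul_eq_one, ← mul_assoc, hββ, hz]
      calc β * α = α⁻¹ * (α * β * (α * β)) * β⁻¹ := by group
        _ = z * α * z * (β * z) := by rw [hγγ, i1, i2]
        _ = α * β * z := by
          have : α * z = z * α := by rw [← h, mul_assoc]
          rw [mul_assoc z α z, this, ← mul_assoc z z, hz, one_mul, ← mul_assoc]
  · set x' := u * x * u⁻¹ with hx'
    have hx'3 : x' ^ 3 = 1 := by rw [hx', conj_pow, hx]; group
    have hzx' : Commute z x' := (hzu.mul_right hzx).mul_right hzu.inv_right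
    have huu : x' = z * (u * x * u) := by
      calc u * x * u⁻¹ = u * (x * z) * u := by rw [hui]; simp only [mul_assoc]
        _ = (u * z) * x * u := by rw [← hzx.eq]; simp only [mul_assoc]
        _ = z * (u * x * u) := by rw [← hzu.eq]; simp only [mul_assoc]
    have hxx : x' * x = z * (u * x) ^ 2 := by
      rw [huu, pow_two]; simp only [mul_assoc]
    have hr : x' * x⁻¹ = z * (u * u1) := by
      rw [huu, hu1]; simp only [mul_assoc]
    have hzux : Commute z (u * x) := hzu.mul_right hzx
    rcases hG.pow_four_or_pow_six (by norm_num) (u * x) with h4 | h6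
    · have hq : (x' * x) * (x' * x) = 1 := by
        rw [hxx, ← pow_two, (hzux.pow_right 2).mul_pow, ← pow_mul, h4, pow_two, hz, one_mul]
      have hqx : Commute (x' * x) x := hG.commute_involution_cube hI hq hx
      have hq1 : x' * x = 1 := by
        have h5 : ((x' * x) * x⁻¹) ^ 3 = 1 := by rw [mul_inv_cancel_right]; exact hx'3
        rw [hqx.inv_right.mul_pow, inv_pow, hx, inv_one, mul_one, pow_succ, pow_two, hq,
          one_mul] at h5
        exact h5
      exact eq_inv_of_mul_eq_one_left hq1
    · exfalso
      have hz3 : z ^ 3 = z := by rw [pow_succ, pow_two, hz, one_mul]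
      have hq : (x' * x) ^ 3 = z := by
        rw [hxx, (hzux.pow_right 2).mul_pow, ← pow_mul, h6, mul_one, hz3]
      have hzr : Commute z (u * u1) :=
        hzu.mul_right ((hzx.mul_right hzu).mul_right hzx.inv_right)
      have hr3 : (x' * x⁻¹) ^ 3 = 1 ∨ (x' * x⁻¹) ^ 3 = z := by
        rw [hr, hzr.mul_pow, hz3]
        rcases h with h | h
        · right; rw [h, mul_one]
        · left; rw [h, hz]
      have := (commute_conj_of_cubes hz hzx' hzx hx'3 hx (Or.inr hq) hr3).2.2
      exact hz1 (hq.symm.trans this)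

/-- Elements `x`, `y` of order dividing three commute as soon as an element `u` of order four
exists: `u` inverts `x` and `y`, and also `x y` up to an involution that commutes with both. -/
theorem InCayleyClass.commute_cubes (hG : InCayleyClass 4 G)
    (hI : ∀ a b : G, a * a = 1 → b * b = 1 → a * b = b * a) {u z : G} (hu : u * u = z)
    (hz : z * z = 1) (hz1 : z ≠ 1) {x y : G} (hx : x ^ 3 = 1) (hy : y ^ 3 = 1) :
    x * y = y * x := by
  have cube : ∀ e : G, e * e = 1 → e ^ 3 = 1 → e = 1 := by
    intro e he he3
    rwa [pow_succ, pow_two, he, one_mul] at he3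
  rcases hG.pow_four_or_pow_six (by norm_num) (x * y) with h | h
  · by_cases h2 : (x * y) * (x * y) = 1
    · have c : Commute (x * y) x := hG.commute_involution_cube hI h2 hx
      have h3 : x * y = 1 := by
        refine cube _ h2 ?_
        have h4 : (x⁻¹ * (x * y)) ^ 3 = 1 := by rw [inv_mul_cancel_left]; exact hy
        rwa [c.symm.inv_left.mul_pow, inv_pow, hx, inv_one, one_mul] at h4
      rw [h3, eq_comm, ← inv_eq_iff_mul_eq_one.mpr h3]; group
    · have h3 := hG.conj_eq_inv hI (u := x * y) rfl
        (by rw [← h]; simp only [pow_succ, pow_zero, one_mul, mul_assoc]) h2 hx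
      have h4 : y * x * y⁻¹ = x⁻¹ := by
        calc y * x * y⁻¹ = x⁻¹ * (x * y * x * (x * y)⁻¹) * x := by group
          _ = x⁻¹ := by rw [h3]; group
      have h5 : x = x⁻¹ := by
        calc x = y ^ 3 * x * (y ^ 3)⁻¹ := by rw [hy]; group
          _ = y * (y * (y * x * y⁻¹) * y⁻¹) * y⁻¹ := by
            simp only [pow_succ, pow_zero, one_mul, mul_inv_rev, mul_assoc]
          _ = y * (y * x⁻¹ * y⁻¹) * y⁻¹ := by rw [h4]
          _ = y * (y * x * y⁻¹)⁻¹ * y⁻¹ := by group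
          _ = y * x * y⁻¹ := by nth_rw 1 [h4]; rw [inv_inv]
          _ = x⁻¹ := h4
      have h6 : x = 1 := cube x (by nth_rw 2 [h5]; group) hx
      rw [h6]; group
  · set i := (x * y) ^ 3 with hi
    have hii : i * i = 1 := by rw [hi, ← pow_add, h]
    have cix : Commute i x := hG.commute_involution_cube hI hii hx
    have ciy : Commute i y := hG.commute_involution_cube hI hii hy
    have hii' : (u * i * u⁻¹) * (u * i * u⁻¹) = 1 := by
      calc (u * i * u⁻¹) * (u * i * u⁻¹) = u * (i * i) * u⁻¹ := by group
        _ = 1 := by rw [hii]; group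
    have cix' : Commute (u * i * u⁻¹) x := hG.commute_involution_cube hI hii' hx
    have ciy' : Commute (u * i * u⁻¹) y := hG.commute_involution_cube hI hii' hy
    have cii : Commute i (u * i * u⁻¹) := hI _ _ hii hii'
    have cixy : Commute i (x * y) := cix.mul_right ciy
    have hw : (x * y * i) ^ 3 = 1 := by
      rw [cixy.symm.mul_pow, ← hi, pow_succ, pow_two, hii, one_mul, hii]
    have h1 := hG.conj_eq_inv hI hu hz hz1 hw
    have h2 := hG.conj_eq_inv hI hu hz hz1 hx
    have h3 := hG.conj_eq_inv hI hu hz hz1 hy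
    set i' := u * i * u⁻¹ with hi'
    have h4 : x⁻¹ * y⁻¹ * i' = y⁻¹ * x⁻¹ * i := by
      calc x⁻¹ * y⁻¹ * i' = u * (x * y * i) * u⁻¹ := by rw [← h2, ← h3, hi']; group
        _ = i⁻¹ * (x * y)⁻¹ := by rw [h1, mul_inv_rev]
        _ = (x * y)⁻¹ * i := by
          rw [inv_eq_of_mul_eq_one_right hii, cixy.inv_right.eq]
        _ = _ := by rw [mul_inv_rev]
    have h5 : x⁻¹ * y⁻¹ * x = y⁻¹ * (i * i') := by
      have : i'⁻¹ = i' := inv_eq_of_mul_eq_one_right hii'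
      have h6 : x⁻¹ * y⁻¹ = y⁻¹ * x⁻¹ * (i * i') := by
        rw [← mul_assoc, ← h4, mul_assoc, hii', mul_one]
      have h7 : Commute (i * i') x := cix.mul_left cix'
      rw [h6, mul_assoc, h7.eq]; group
    have hee : (i * i') * (i * i') = 1 := by
      nth_rw 2 [cii.eq]
      rw [mul_assoc, ← mul_assoc i', hii', one_mul, hii]
    have he : i * i' = 1 := by
      refine cube _ hee ?_
      have h8 : (x⁻¹ * y⁻¹ * x) ^ 3 = 1 := by
        have : x⁻¹ * y⁻¹ * x = x⁻¹ * y⁻¹ * x⁻¹⁻¹ := by rw [inv_inv]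
        rw [this, conj_pow, inv_pow, hy]; group
      have h7 : Commute (i * i') y := ciy.mul_left ciy'
      rwa [h5, h7.inv_right.symm.mul_pow, inv_pow, hy, inv_one, one_mul] at h8
    rw [he, mul_one] at h5
    have hc : Commute y⁻¹ x := by
      calc y⁻¹ * x = x * (x⁻¹ * y⁻¹ * x) := by group
        _ = x * y⁻¹ := by rw [h5]
    exact (by simpa using hc.inv_left : Commute y x).symm

/-- The square of an element `u` of order four is the only involution. An involution `j ≠ u²` that
commutes with `u` would give the elements `u` and `u x j` of order four, with the same square, whose
product has order six modulo that square. -/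
theorem InCayleyClass.involution_unique (hG : InCayleyClass 4 G)
    (hI : ∀ a b : G, a * a = 1 → b * b = 1 → a * b = b * a) {u x z : G} (hu : u * u = z)
    (hz : z * z = 1) (hz1 : z ≠ 1) (hx : x ^ 3 = 1) (hx1 : x ≠ 1) {i : G} (hi : i * i = 1) :
    i = 1 ∨ i = z := by
  have key : ∀ j : G, j * j = 1 → Commute j u → j = 1 ∨ j = z := by
    intro j hj hju
    have hjx : Commute j x := hG.commute_involution_cube hI hj hx
    have hzx : Commute z x := hG.commute_involution_cube hI hz hx
    have hjux : Commute j (u * x) := hju.mul_right hjx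
    have hv : (u * x * j) * (u * x * j) = z := by
      have h1 := hG.conj_eq_inv hI hu hz hz1 hx
      calc (u * x * j) * (u * x * j) = (u * x) * (j * (u * x)) * j := by simp only [mul_assoc]
        _ = (u * x) * (u * x) * (j * j) := by rw [hjux.eq]; simp only [mul_assoc]
        _ = (u * x * u⁻¹) * (u * u) * x := by rw [hj]; group
        _ = z := by rw [h1, hu, mul_assoc, hzx.eq]; group
    have hr : u * (u * x * j) = z * (x * j) := by rw [← hu]; simp only [mul_assoc]
    have hzj : Commute z j := hI z j hz hj
    have hr' : ∀ n, (u * (u * x * j)) ^ n = z ^ n * (x ^ n * j ^ n) := by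
      intro n
      rw [hr, (hzx.mul_right hzj).mul_pow, hjx.symm.mul_pow]
    have hx2 : x ^ 2 ≠ 1 := by
      intro h
      rw [pow_succ, h, one_mul] at hx
      exact hx1 hx
    rcases hG.sq_or_cube_mul hu hv hz with h | h <;> rw [hr'] at h
    · exfalso
      rw [pow_two, pow_two j, hz, hj, one_mul, mul_one] at h
      rcases h with h | h
      · exact hx2 h
      · refine hx1 ?_
        calc x = x ^ 3 * x := by rw [hx, one_mul]
          _ = x ^ 2 * x ^ 2 := by rw [← pow_succ, ← pow_add]
          _ = 1 := by rw [h, hz]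
    · rw [hx, one_mul, pow_succ, pow_two, hz, one_mul, pow_succ, pow_two, hj, one_mul] at h
      rcases h with h | h
      · right
        rw [← inv_eq_of_mul_eq_one_right h, inv_eq_of_mul_eq_one_right hz]
      · left
        simpa using h
  set i' := u * i * u⁻¹ with hi'
  have hii' : i' * i' = 1 := by
    calc i' * i' = u * (i * i) * u⁻¹ := by rw [hi']; group
      _ = 1 := by rw [hi]; group
  have cii : i * i' = i' * i := hI i i' hi hii'
  have hu2 : u * i' * u⁻¹ = i := by
    have hzi : z * i = i * z := hI z i hz hi
    calc u * i' * u⁻¹ = (u * u) * i * (u * u)⁻¹ := by rw [hi']; group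
      _ = i := by rw [hu, hzi]; group
  have hj : (i * i') * (i * i') = 1 := by
    nth_rw 2 [cii]
    rw [mul_assoc, ← mul_assoc i', hii', one_mul, hi]
  have hju : Commute (i * i') u := by
    refine (mul_inv_eq_iff_eq_mul.mp (?_ : u * (i * i') * u⁻¹ = i * i')).symm
    calc u * (i * i') * u⁻¹ = (u * i * u⁻¹) * (u * i' * u⁻¹) := by group
      _ = i * i' := by rw [hu2, ← hi', cii]
  have hfix : i' = i → i = 1 ∨ i = z := fun h =>
    key i hi (mul_inv_eq_iff_eq_mul.mp h).symm
  rcases key _ hj hju with h | h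
  · exact hfix (by rw [← mul_right_inj i, h, hi])
  · -- Here `⟨i, u⟩` would be dihedral of order eight, with the involutions `i` and `i u`.
    refine hfix (?_ : u * i * u⁻¹ = i)
    have h1 : (i * u) * (i * u) = 1 := by
      calc (i * u) * (i * u) = i * (u * i * u⁻¹) * (u * u) := by group
        _ = 1 := by rw [← hi', h, hu, hz]
    have h2 := hI i (i * u) hi h1
    rw [mul_inv_eq_iff_eq_mul]
    rw [mul_assoc] at h2
    exact (mul_left_cancel h2).symm

end CommutingInvolutions

/-! ### A criterion for nilpotency -/

/-- A finite group with elements of orders `1`, `2`, `3`, `4`, `6` only is nilpotent as soon as its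
`2`-elements commute with its `3`-elements: the normalizer of a Sylow subgroup then contains a Sylow
subgroup for each prime. -/
theorem isNilpotent_of_commute {G : Type*} [Group G] [Finite G]
    (h46 : ∀ g : G, g ^ 4 = 1 ∨ g ^ 6 = 1)
    (hc : ∀ g h : G, g ^ 4 = 1 → h ^ 3 = 1 → g * h = h * g) : Group.IsNilpotent G := by
  refine (Group.isNilpotent_of_finite_tfae.out 0 3).mpr fun p hp P => ?_
  have prime_cases : ∀ q : ℕ, q.Prime → q ∣ Nat.card G → q = 2 ∨ q = 3 := by
    intro q hq hqG
    have := Fact.mk hq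
    obtain ⟨g, hg⟩ := exists_prime_orderOf_dvd_card' q hqG
    have h12 : g ^ 12 = 1 := by
      rcases h46 g with h | h
      · rw [show 12 = 4 * 3 from rfl, pow_mul, h, one_pow]
      · rw [show 12 = 6 * 2 from rfl, pow_mul, h, one_pow]
    have hdvd : q ∣ 2 ^ 2 * 3 := by rw [← hg]; exact orderOf_dvd_of_pow_eq_one h12
    rcases (Nat.Prime.dvd_mul hq).mp hdvd with h | h
    · exact Or.inl ((Nat.prime_dvd_prime_iff_eq hq Nat.prime_two).mp (hq.dvd_of_dvd_pow h))
    · exact Or.inr ((Nat.prime_dvd_prime_iff_eq hq Nat.prime_three).mp h)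
  have pow2 : ∀ (Q : Sylow 2 G) (g : G), g ∈ Q → g ^ 4 = 1 := by
    intro Q g hg
    obtain ⟨k, hk⟩ := Q.isPGroup' ⟨g, hg⟩
    have hk' : g ^ 2 ^ k = 1 := congrArg Subtype.val hk
    have hdvd : orderOf g ∣ 2 ^ k := orderOf_dvd_of_pow_eq_one hk'
    apply orderOf_dvd_iff_pow_eq_one.mp
    rcases h46 g with h | h
    · exact orderOf_dvd_of_pow_eq_one h
    · have h6 : orderOf g ∣ 2 * 3 := orderOf_dvd_of_pow_eq_one h
      have hcop : (orderOf g).Coprime 3 :=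
        Nat.Coprime.coprime_dvd_left hdvd (Nat.Coprime.pow_left k (by norm_num))
      exact (hcop.dvd_of_dvd_mul_right h6).trans (by norm_num)
  have pow3 : ∀ (Q : Sylow 3 G) (g : G), g ∈ Q → g ^ 3 = 1 := by
    intro Q g hg
    obtain ⟨k, hk⟩ := Q.isPGroup' ⟨g, hg⟩
    have hk' : g ^ 3 ^ k = 1 := congrArg Subtype.val hk
    have hdvd : orderOf g ∣ 3 ^ k := orderOf_dvd_of_pow_eq_one hk'
    apply orderOf_dvd_iff_pow_eq_one.mp
    rcases h46 g with h | h
    · have hcop : (orderOf g).Coprime (4 * 1) :=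
        Nat.Coprime.coprime_dvd_left hdvd (Nat.Coprime.pow_left k (by norm_num))
      have h4 : orderOf g ∣ 4 * 1 := orderOf_dvd_of_pow_eq_one h
      rw [Nat.Coprime.eq_one_of_dvd hcop h4]
      exact one_dvd _
    · have h6 : orderOf g ∣ 2 * 3 := orderOf_dvd_of_pow_eq_one h
      have hcop : (orderOf g).Coprime 2 :=
        Nat.Coprime.coprime_dvd_left hdvd (Nat.Coprime.pow_left k (by norm_num))
      exact hcop.dvd_of_dvd_mul_left h6
  have normalizes : ∀ H K : Subgroup G, (∀ h ∈ H, ∀ k ∈ K, h * k = k * h) →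
      K ≤ Subgroup.normalizer (H : Set G) := by
    intro H K hHK k hk
    rw [Subgroup.mem_normalizer_iff]
    have fwd : ∀ k ∈ K, ∀ h ∈ H, k * h * k⁻¹ = h := by
      intro k hk h hh
      rw [← hHK h hh k hk]; group
    intro h
    refine ⟨fun hh => by rwa [fwd k hk h hh], fun hh => ?_⟩
    have := fwd k⁻¹ (K.inv_mem hk) _ hh
    have h2 : h = k * h * k⁻¹ := by rw [← this]; group
    rw [h2]; exact hh
  have sylow_le : ∀ q : ℕ, q.Prime → q ∣ Nat.card G →
      ∃ Q : Sylow q G, (Q : Subgroup G) ≤ Subgroup.normalizer ((P : Subgroup G) : Set G) := by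
    intro q hq hqG
    have := Fact.mk hq
    by_cases hpq : q = p
    · subst hpq
      exact ⟨P, Subgroup.le_normalizer⟩
    refine ⟨default, ?_⟩
    by_cases hpG : p ∣ Nat.card G
    · apply normalizes
      rcases prime_cases p hp.out hpG with rfl | rfl <;>
        rcases prime_cases q hq hqG with rfl | rfl
      · exact absurd rfl hpq
      · exact fun h hh k hk => hc h k (pow2 _ h hh) (pow3 _ k hk)
      · exact fun h hh k hk => (hc k h (pow2 _ k hk) (pow3 _ h hh)).symm
      · exact absurd rfl hpq
    · apply normalizes
      intro h hh k _
      obtain ⟨n, hn⟩ := P.isPGroup' ⟨h, hh⟩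
      have hn' : h ^ p ^ n = 1 := congrArg Subtype.val hn
      have hcop : (Nat.card G).Coprime (p ^ n) :=
        (((Nat.Prime.coprime_iff_not_dvd hp.out).mpr hpG).pow_left n).symm
      have h1 : h = 1 := by
        rw [← orderOf_eq_one_iff]
        exact Nat.eq_one_of_dvd_coprimes hcop (orderOf_dvd_natCard h)
          (orderOf_dvd_of_pow_eq_one hn')
      rw [h1, one_mul, mul_one]
  rw [← Subgroup.normalizer_eq_top_iff, ← Subgroup.index_eq_one]
  by_contra hidx
  obtain ⟨q, hq, hqi⟩ := Nat.exists_prime_and_dvd hidx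
  have := Fact.mk hq
  obtain ⟨Q, hQ⟩ := sylow_le q hq (hqi.trans (Subgroup.index_dvd_card _))
  exact Q.not_dvd_index (hqi.trans (Subgroup.index_dvd_of_le hQ))

/-! ### Recognition of the generalized dicyclic groups -/

/-- The reduction `ℤ₆ → ℤ₃`. -/
abbrev castSixThree : ZMod 6 →+* ZMod 3 := ZMod.castHom (by norm_num) (ZMod 3)

theorem castSixThree_three : castSixThree 3 = 0 := by decide

theorem eq_zero_of_castSixThree : ∀ k, castSixThree k = 0 → k.val % 2 = 0 → k = 0 := by decide

theorem exists_castSixThree_even : ∀ k, ∃ l, castSixThree l = k ∧ l.val % 2 = 0 := by decide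

theorem exists_castSixThree_odd : ∀ k, ∃ l, castSixThree l = k ∧ l.val % 2 = 1 := by decide

/-- Recognition of `Dic(ℤ₃ⁿ × ℤ₆)`. The elements of order dividing three form a vector space over
`ℤ₃` of positive dimension, and with the involution `z = u²` they generate the subgroup of index two
that `u` inverts. -/
theorem exists_mulEquiv_dicThreeSix {G : Type*} [Group G] [Finite G] {u x z : G}
    (h46 : ∀ g : G, g ^ 4 = 1 ∨ g ^ 6 = 1) (hu : u * u = z) (hz : z * z = 1) (hz1 : z ≠ 1)
    (hx : x ^ 3 = 1) (hx1 : x ≠ 1) (hcomm : ∀ x y : G, x ^ 3 = 1 → y ^ 3 = 1 → x * y = y * x)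
    (hinv : ∀ v y : G, v ^ 4 = 1 → v * v ≠ 1 → y ^ 3 = 1 → v * y * v⁻¹ = y⁻¹)
    (huniq : ∀ i : G, i * i = 1 → i = 1 ∨ i = z) : ∃ n : ℕ, Nonempty (G ≃* DicThreeSix n) := by
  have hcentral : ∀ g : G, Commute z g := by
    intro g
    have h1 : (g * z * g⁻¹) * (g * z * g⁻¹) = 1 := by
      calc (g * z * g⁻¹) * (g * z * g⁻¹) = g * (z * z) * g⁻¹ := by group
        _ = 1 := by rw [hz]; group
    rcases huniq _ h1 with h | h
    · exact absurd (conj_eq_one_iff.mp h) hz1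
    · exact (mul_inv_eq_iff_eq_mul.mp h).symm
  have hu4 : u ^ 4 = 1 := by
    rw [show 4 = 2 * 2 from rfl, pow_mul, pow_two u, hu, pow_two, hz]
  let P : Subgroup G :=
    { carrier := {g | g ^ 3 = 1}
      one_mem' := one_pow 3
      mul_mem' := by
        intro a b (ha : a ^ 3 = 1) (hb : b ^ 3 = 1)
        have h : Commute a b := hcomm a b ha hb
        change (a * b) ^ 3 = 1
        rw [h.mul_pow, ha, hb, one_mul]
      inv_mem' := by
        intro a (ha : a ^ 3 = 1)
        change a⁻¹ ^ 3 = 1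
        rw [inv_pow, ha, inv_one] }
  let _ : CommGroup P := { (inferInstance : Group P) with
    mul_comm := fun a b => Subtype.ext (hcomm a b a.2 b.2) }
  let _ : Module (ZMod 3) (Additive P) := AddCommGroup.zmodModule (n := 3) (fun a => by
    change Additive.ofMul (a.toMul ^ 3) = 0
    have : a.toMul ^ 3 = 1 := Subtype.ext a.toMul.2
    rw [this]; rfl)
  have : Fact (Nat.Prime 3) := ⟨Nat.prime_three⟩
  have : Finite (Additive P) := inferInstanceAs (Finite P)
  have : Nontrivial (Additive P) := ⟨Additive.ofMul ⟨x, hx⟩, 0, fun h => hx1 (congrArg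
    (fun y : Additive P => (y.toMul : G)) h)⟩
  obtain ⟨n, hn⟩ : ∃ n, Module.finrank (ZMod 3) (Additive P) = n + 1 :=
    Nat.exists_eq_succ_of_ne_zero (Module.finrank_pos (R := ZMod 3) (M := Additive P)).ne'
  let e : ((Fin n → ZMod 3) × ZMod 3) ≃ₗ[ZMod 3] Additive P :=
    LinearEquiv.ofFinrankEq _ _ (by simp [hn])
  let p : (Fin n → ZMod 3) × ZMod 3 → G := fun a => ((e a).toMul : G)
  have p_add : ∀ a b, p (a + b) = p a * p b := by
    intro a b
    simp only [p, map_add]; rfl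
  have p_cube : ∀ a, p a ^ 3 = 1 := fun a => (e a).toMul.2
  have p_zero : p 0 = 1 := by simp only [p, map_zero]; rfl
  have p_inj : ∀ a, p a = 1 → a = 0 := by
    intro a ha
    have : e a = 0 := by
      have h : (e a).toMul = 1 := Subtype.ext ha
      exact h
    simpa using this
  have p_surj : ∀ g : G, g ^ 3 = 1 → ∃ a, p a = g := by
    intro g hg
    exact ⟨e.symm (Additive.ofMul ⟨g, hg⟩), by simp [p]⟩
  have zpow_mod : ∀ m : ℕ, z ^ m = z ^ (m % 2) := by
    intro m
    conv_lhs => rw [← Nat.mod_add_div m 2, pow_add, pow_mul, pow_two, hz, one_pow, mul_one]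
  let ψ : (Fin n → ZMod 3) × ZMod 6 → G := fun a => p (a.1, castSixThree a.2) * z ^ a.2.val
  have ψ_add : ∀ a b, ψ (a + b) = ψ a * ψ b := by
    intro a b
    have h1 : ∀ k l : ZMod 6, (k + l).val % 2 = (k.val + l.val) % 2 := by decide
    have h2 : z ^ (a.2 + b.2).val = z ^ a.2.val * z ^ b.2.val := by
      rw [zpow_mod, h1, ← zpow_mod, pow_add]
    have h3 : (a.1 + b.1, castSixThree (a.2 + b.2)) =
        (a.1, castSixThree a.2) + (b.1, castSixThree b.2) := by
      rw [map_add]; rfl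
    change p (a.1 + b.1, castSixThree (a.2 + b.2)) * z ^ (a.2 + b.2).val = _
    rw [h3, p_add, h2]
    have h4 : Commute (z ^ a.2.val) (p (b.1, castSixThree b.2)) := (hcentral _).pow_left _
    change _ = p (a.1, castSixThree a.2) * z ^ a.2.val * (p (b.1, castSixThree b.2) * z ^ b.2.val)
    rw [mul_assoc, mul_assoc, ← mul_assoc (z ^ a.2.val), h4.eq]
    simp only [mul_assoc]
  have ψ_zero : ψ 0 = 1 := by
    have := ψ_add 0 0
    rw [add_zero] at this
    exact (left_eq_mul.mp this)
  have ψ_neg : ∀ a, ψ (-a) = (ψ a)⁻¹ := by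
    intro a
    rw [eq_inv_iff_mul_eq_one, ← ψ_add, neg_add_cancel, ψ_zero]
  have ψ_y : ψ (0, 3) = z := by
    have h2 : (3 : ZMod 6).val = 3 := by decide
    change p (0, castSixThree 3) * z ^ (3 : ZMod 6).val = z
    rw [castSixThree_three, h2, show ((0 : Fin n → ZMod 3), (0 : ZMod 3)) = 0 from rfl, p_zero,
      one_mul, pow_succ, pow_two, hz, one_mul]
  have u_ψ : ∀ a, u * ψ a = ψ (-a) * u := by
    intro a
    rw [ψ_neg]
    have h1 : u * p (a.1, castSixThree a.2) * u⁻¹ = (p (a.1, castSixThree a.2))⁻¹ :=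
      hinv u _ hu4 (by rw [hu]; exact hz1) (p_cube _)
    have h2 : (z ^ a.2.val)⁻¹ = z ^ a.2.val := by
      rw [← inv_pow, inv_eq_of_mul_eq_one_right hz]
    have h3 : Commute (z ^ a.2.val) u := (hcentral u).pow_left _
    change u * (p (a.1, castSixThree a.2) * z ^ a.2.val) =
      (p (a.1, castSixThree a.2) * z ^ a.2.val)⁻¹ * u
    have h4 : Commute (z ^ a.2.val) (u * p (a.1, castSixThree a.2)) := (hcentral _).pow_left _
    rw [mul_inv_rev, h2, ← h1, ← mul_assoc u, ← h4.eq, mul_assoc, inv_mul_cancel_right]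
  have ψ_six : ∀ a, ψ a ^ 6 = 1 := by
    intro a
    have h : Commute (p (a.1, castSixThree a.2)) (z ^ a.2.val) := ((hcentral _).pow_left _).symm
    change (p (a.1, castSixThree a.2) * z ^ a.2.val) ^ 6 = 1
    have h6 : ∀ g : G, g ^ 6 = (g ^ 3) ^ 2 := fun g => by rw [← pow_mul]
    have heven : a.2.val * 6 % 2 = 0 := by omega
    rw [h.mul_pow, h6, p_cube, one_pow, one_mul, ← pow_mul, zpow_mod, heven, pow_zero]
  let Θ : DicThreeSix n →* G := MonoidHom.mk' (fun d => match d with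
    | .of a => ψ a
    | .ofX a => ψ a * u) (by
      rintro (a | a) (b | b)
      · exact ψ_add a b
      · change ψ (a + b) * u = ψ a * (ψ b * u)
        rw [ψ_add, mul_assoc]
      · change ψ (a - b) * u = ψ a * u * ψ b
        rw [mul_assoc (ψ a) u (ψ b), u_ψ, sub_eq_add_neg, ψ_add, mul_assoc (ψ a)]
      · change ψ (a - b + (0, 3)) = ψ a * u * (ψ b * u)
        rw [ψ_add, ψ_y, sub_eq_add_neg, ψ_add, ← hu, mul_assoc (ψ a) u, ← mul_assoc u, u_ψ]
        simp only [mul_assoc])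
  have Θ_inj : Function.Injective Θ := by
    rw [injective_iff_map_eq_one]
    rintro (a | a) ha
    · change p (a.1, castSixThree a.2) * z ^ a.2.val = 1 at ha
      have h : Commute (p (a.1, castSixThree a.2)) (z ^ a.2.val) := ((hcentral _).pow_left _).symm
      have h3 : z ^ a.2.val = 1 := by
        have h4 : (p (a.1, castSixThree a.2) * z ^ a.2.val) ^ 3 = 1 := by rw [ha, one_pow]
        rw [h.mul_pow, p_cube, one_mul, ← pow_mul, zpow_mod, Nat.mul_mod] at h4
        rw [zpow_mod]
        simpa using h4
      rw [h3, mul_one] at ha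
      have h4 := p_inj _ ha
      have h5 : a.1 = 0 := congrArg Prod.fst h4
      have h6 : castSixThree a.2 = 0 := congrArg Prod.snd h4
      have h7 : a.2.val % 2 = 0 := by
        rw [zpow_mod] at h3
        rcases Nat.mod_two_eq_zero_or_one a.2.val with h | h
        · exact h
        · rw [h, pow_one] at h3
          exact absurd h3 hz1
      have h9 : a = 0 := Prod.ext h5 (eq_zero_of_castSixThree _ h6 h7)
      rw [h9]; rfl
    · change ψ a * u = 1 at ha
      exfalso
      have h1 : u⁻¹ = ψ a := (eq_inv_of_mul_eq_one_left ha).symm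
      have h2 := ψ_six a
      rw [← h1, inv_pow, inv_eq_one, show 6 = 4 + 2 from rfl, pow_add, hu4, one_mul, pow_two,
        hu] at h2
      exact hz1 h2
  have six_mem : ∀ g : G, g ^ 6 = 1 → ∃ a, ψ a = g := by
    intro g hg
    obtain ⟨a, ha⟩ := p_surj (g ^ 4) (by
      rw [← pow_mul, show 4 * 3 = 6 * 2 from rfl, pow_mul, hg, one_pow])
    have hg43 : g ^ 4 * g ^ 3 = g := by
      rw [← pow_add, show 4 + 3 = 6 + 1 from rfl, pow_add, hg, one_mul, pow_one]
    rcases huniq (g ^ 3) (by rw [← pow_add]; exact hg) with h3 | h3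
    · obtain ⟨l, hl, hl2⟩ := exists_castSixThree_even a.2
      refine ⟨(a.1, l), ?_⟩
      change p (a.1, castSixThree l) * z ^ l.val = g
      rw [zpow_mod, hl2, pow_zero, ← h3, hl, show (a.1, a.2) = a from rfl, ha,
        hg43]
    · obtain ⟨l, hl, hl2⟩ := exists_castSixThree_odd a.2
      refine ⟨(a.1, l), ?_⟩
      change p (a.1, castSixThree l) * z ^ l.val = g
      rw [zpow_mod, hl2, pow_one, ← h3, hl, show (a.1, a.2) = a from rfl, ha,
        hg43]
  have Θ_surj : Function.Surjective Θ := by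
    intro g
    by_cases hg : g ^ 6 = 1
    · obtain ⟨a, ha⟩ := six_mem g hg
      exact ⟨.of a, ha⟩
    · have hg4 := (h46 g).resolve_right hg
      have hg2 : g * g ≠ 1 := by
        intro h
        apply hg
        rw [show 6 = 2 * 3 from rfl, pow_mul, pow_two, h, one_pow]
      -- The product of two elements of order four centralizes `x`, so its order is not four.
      have h6 : (g * u⁻¹) ^ 6 = 1 := by
        by_contra h
        have h4 := (h46 _).resolve_right h
        have h2 : (g * u⁻¹) * (g * u⁻¹) ≠ 1 := by
          intro h'
          apply h
          rw [show 6 = 2 * 3 from rfl, pow_mul, pow_two, h', one_pow]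
        have h7 := hinv _ x h4 h2 hx
        have h8 : u⁻¹ * x * u = x⁻¹ := by
          have := hinv u x⁻¹ hu4 (by rw [hu]; exact hz1) (by rw [inv_pow, hx, inv_one])
          rw [inv_inv] at this
          nth_rw 1 [← this]; group
        have h9 : x = x⁻¹ := by
          calc x = g * x⁻¹ * g⁻¹ := by
                rw [hinv g x⁻¹ hg4 hg2 (by rw [inv_pow, hx, inv_one]), inv_inv]
            _ = (g * u⁻¹) * x * (g * u⁻¹)⁻¹ := by rw [← h8]; group
            _ = x⁻¹ := h7
        have h10 : x * x = 1 := by nth_rw 2 [h9]; group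
        rw [pow_succ, pow_two, h10, one_mul] at hx
        exact hx1 hx
      obtain ⟨a, ha⟩ := six_mem _ h6
      refine ⟨.ofX a, ?_⟩
      change ψ a * u = g
      rw [ha]; group
  exact ⟨n, ⟨(MulEquiv.ofBijective Θ ⟨Θ_inj, Θ_surj⟩).symm⟩⟩

/-! ### The classification -/

theorem lemma3p2 {G : Type*} [Group G] [Fintype G] (hG : ¬ Group.IsNilpotent G)
    (h4 : InCayleyClass 4 G) :
    Nonempty (G ≃* Equiv.Perm (Fin 3)) ∨ ∃ n : ℕ, Nonempty (G ≃* DicThreeSix n) := by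
  by_cases hI : ∀ a b : G, a * a = 1 → b * b = 1 → a * b = b * a
  · right
    have h46 := h4.pow_four_or_pow_six (by norm_num)
    have sq : ∀ g : G, g ^ 4 = 1 → (g * g) * (g * g) = 1 := by
      intro g hg
      rw [← hg]; simp only [pow_succ, pow_zero, one_mul, mul_assoc]
    obtain ⟨u, x, hu, hx, hux⟩ : ∃ u x : G, u ^ 4 = 1 ∧ x ^ 3 = 1 ∧ u * x ≠ x * u := by
      by_contra! h
      exact hG (isNilpotent_of_commute h46 h)
    have hz1 : u * u ≠ 1 := fun h => hux (h4.commute_involution_cube hI h hx)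
    exact exists_mulEquiv_dicThreeSix h46 rfl (sq u hu) hz1 hx
      (by rintro rfl; simp at hux)
      (fun _ _ => h4.commute_cubes hI rfl (sq u hu) hz1)
      (fun v _ hv hv1 => h4.conj_eq_inv hI rfl (sq v hv) hv1)
      (fun _ => h4.involution_unique hI rfl (sq u hu) hz1 hx (by rintro rfl; simp at hux))
  · left
    push Not at hI
    obtain ⟨a, b, ha, hb, hab⟩ := hI
    exact h4.nonempty_mulEquiv_perm ha hb hab
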